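/- For $\rho>0$ and $z\in\mathbb R$ let $E_\rho(z)=\sum_{k\ge 0} z^k/\Gamma(\rho k+1)$ be the Mittag-Leffler function, and put $e_\lambda(\rho)=E_\rho(-\lambda t_0^\rho)$, so that $e_\lambda(1)=e^{-\lambda t_0}$. Let $\rho_0\in(0,1)$, $\lambda_0>0$, $B_1=43$, $B_2=4.6$. There exist real numbers $k$ with $$k\ \ge\ \frac1{\rho_0}\max\Big\{\frac{B_1}{B_2},\ \ln\frac{2B_2k}{\lambda_0}\Big\},$$ and for every such $k$ the number $T_0=T_0(\lambda_0,\rho_0)=e^k$ has the following properties for all $t_0\ge T_0$. (a) For every $\lambda\ge\lambda_0$ the function $\rho\mapsto e_\lambda(\rho)$ is positive and strictly decreasing on $[\rho_0,1)$, and $$e_\lambda(1)<e_\lambda(\rho)\le e_\lambda(\rho_0),\qquad \rho\in[\rho_0,1).$$ (b) Let $A(\xi)$ be a real homogeneous polynomial on $\mathbb R^N$ of even degree $m=2l\ge2$ with $A(\xi)>0$ for $\xi\ne0$, and let $\varphi\in L_2(\mathbb R^N)$, with Fourier transform normalized by $\hat f(\xi)=(2\pi)^{-N}\int_{\mathbb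 R^N}f(x)e^{-ix\xi}\,dx$. Let $\xi_0\ne0$ satisfy $A(\xi_0)=\lambda_0$ and $\hat\varphi(\xi_0)\neq0$. Then for every $\rho\in[\rho_0,1]$ the solution $$u_\rho(x,t_0)=\int_{\mathbb R^N}E_\rho(-A(\xi)t_0^\rho)\,\hat\varphi(\xi)\,e^{ix\xi}\,d\xi$$ of the forward problem (the Cauchy problem for the subdiffusion equation $D_t^\rho u+A(D)u=0$ with initial function $\varphi$, where $A(D)$ acts on the Fourier side as multiplication by $A(\xi)$) exists at time $t_0$ as an element of $L_2(\mathbb R^N)$, the integral being the $L_2$-limit, as $\mu\to\infty$, of the integrals over $\{A(\xi)<\mu\}$; and $U(t_0,\rho)=|\hat u_\rho(\xi_0,t_0)|$ is strictly decreasing in $\rho\in[\rho_0,1]$. Here the value at $\xi_0$ of the Fourier transform of an $L_2$ function is understood in the sense of Lebesgue points: $g(\xi_0)=c$ means that the mean of $|g-c|$ over the ball of radius $r$ about $\xi_0$ tends to $0$ as $r\to0^+$. The existence of such a value is assumed for $\hat\varphi$ and is part of the claim for $\hat u_\rho(\cdot,t_0)$. -/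

import Mathlib

open Set Filter Topology MeasureTheory FourierTransform

noncomputable section

/-- The Mittag-Leffler function `E_ρ(z) = ∑_{k ≥ 0} z ^ k / Γ(ρ k + 1)` of a real argument. -/
def mittagLeffler (ρ z : ℝ) : ℝ := ∑' k : ℕ, z ^ k / Real.Gamma (ρ * k + 1)

/-- The function `e_lam(ρ) = E_ρ(-lam t₀ ^ ρ)`. -/
def eFun (lam t₀ ρ : ℝ) : ℝ := mittagLeffler ρ (-(lam * t₀ ^ ρ))

/-- `T₀ = e ^ k` is an admissible choice of the threshold:
`k ≥ (1 / ρ₀) max {B₁ / B₂, ln (2 B₂ k / lam₀)}` with `B₁ = 43` and `B₂ = 4.6`. -/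
def AdmissibleExponent (lam₀ ρ₀ k : ℝ) : Prop :=
  1 / ρ₀ * max (43 / 4.6) (Real.log (2 * 4.6 * k / lam₀)) ≤ k

/-- The real polynomial `P` in `N` variables is homogeneous of even order `2 l` with `l ≥ 1` and
elliptic: it is positive away from the origin. -/
structure IsEllipticSymbol {N : ℕ} (l : ℕ) (P : MvPolynomial (Fin N) ℝ) : Prop where
  order_pos : 0 < l
  homogeneous : P.IsHomogeneous (2 * l)
  pos : ∀ ξ : Fin N → ℝ, ξ ≠ 0 → 0 < MvPolynomial.eval ξ P

/-- The value `A(ξ)` of the symbol at a point of Euclidean space. -/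
def symbolAt {N : ℕ} (P : MvPolynomial (Fin N) ℝ) (ξ : EuclideanSpace ℝ (Fin N)) : ℝ :=
  MvPolynomial.eval (fun j => ξ j) P

/-- The complex space `L₂(ℝ^N)`. -/
abbrev LTwo (N : ℕ) : Type :=
  Lp ℂ 2 (volume : Measure (EuclideanSpace ℝ (Fin N)))

/-- The Fourier transform of `f ∈ L₂(ℝ^N)` with the normalization
`f^(ξ) = (2π)^(-N) ∫ f(x) e^(-i x ξ) dx`. It is expressed through the `L₂` Fourier transform `𝓕` of
Mathlib, which extends `(𝓕 f)(η) = ∫ f(x) e^(-2π i x η) dx`. The result is a function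
determined up to a null set. -/
def fourierHat {N : ℕ} (f : LTwo N) (ξ : EuclideanSpace ℝ (Fin N)) : ℂ :=
  ((((2 * Real.pi) ^ N)⁻¹ : ℝ) : ℂ) * (𝓕 f : LTwo N) ((2 * Real.pi)⁻¹ • ξ)

/-- The function `f`, determined up to a null set, has the value `c` at `ξ₀`: the point `ξ₀` is a
Lebesgue point of `f` with value `c`, that is, the mean of `|f - c|` over the ball of
radius `r` about `ξ₀` tends to `0` as `r → 0+`. -/
def HasValueAt {N : ℕ} (f : EuclideanSpace ℝ (Fin N) → ℂ) (ξ₀ : EuclideanSpace ℝ (Fin N))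
    (c : ℂ) : Prop :=
  Tendsto (fun r : ℝ => ⨍⁻ ξ in Metric.ball ξ₀ r, ‖f ξ - c‖ₑ ∂volume) (𝓝[>] 0) (𝓝 0)

/-- The truncated integral
`S_μ(x, t) = ∫_{A(ξ) < μ} E_ρ(-A(ξ) t ^ ρ) φ^(ξ) e^(i x ξ) dξ`. -/
def truncatedSolution {N : ℕ} (P : MvPolynomial (Fin N) ℝ) (φ : LTwo N) (ρ t μ : ℝ)
    (x : EuclideanSpace ℝ (Fin N)) : ℂ :=
  ∫ ξ in {ξ : EuclideanSpace ℝ (Fin N) | symbolAt P ξ < μ},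
    (mittagLeffler ρ (-(symbolAt P ξ * t ^ ρ)) : ℂ) * fourierHat φ ξ *
      Complex.exp (Complex.I * (inner ℝ x ξ : ℝ))

/-- `u = u(·, t)` is the solution at time `t` of the forward problem of order `ρ` with symbol `P`
and initial function `φ ∈ L₂(ℝ^N)`, given by
`u(x, t) = ∫ E_ρ(-A(ξ) t ^ ρ) φ^(ξ) e^(i x ξ) dξ`. For `φ ∈ L₂` the integral over `ℝ^N` is
the limit in `L₂` of the truncated integrals `S_μ(·, t)` as `μ → ∞`. -/
def IsForwardSolution {N : ℕ} (P : MvPolynomial (Fin N) ℝ) (φ : LTwo N) (ρ t : ℝ)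
    (u : LTwo N) : Prop :=
  Tendsto (fun μ : ℝ => eLpNorm (fun x => truncatedSolution P φ ρ t μ x - u x) 2 volume)
    atTop (𝓝 0)

end

noncomputable section

/-! Write `ℓ = log t₀`, `z = lam * exp (ℓ * ρ)` and `q = z * exp (-ρ w)`. In the logarithmic
coordinate Hankel's formula reads `1 / Γ(a + 1) = (2πi)⁻¹ ∫ exp (e ^ w - a w) dw`. Summing a
geometric series under the integral gives `E_ρ(-z) = (2πi)⁻¹ ∫ exp (e ^ w) / (1 + q) dw`. All
kernels are real on the real axis, so half of the contour and an imaginary part suffice.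

Since `1 / (1 + q) = 1 / q - 1 / (q (1 + q))`, the function `E_ρ(-z)` is the leading term `1 / (z
Γ(1 - ρ))` minus a remainder. Between two orders `ρ < σ` the leading term drops by at least `(σ - ρ)
/ (lam * exp (ℓ * σ))` (`le_leadingTerm_sub`). The remainder, multiplied by `π`, changes by at most
`22 ℓ (σ - ρ) / z ^ 2` (`abs_halfHankel_remainderKernel_sub_le`); this comes from the mean value
inequality applied to the kernel pointwise, so nothing is differentiated under the integral. The
threshold gives `ℓ ≥ 9.3` and `z ≥ 9.2 ℓ`, and then the leading term wins for close orders
(`eFun_lt_of_close`). Chaining small steps yields strict decrease on all of `[ρ₀, 1]`, and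
positivity follows from the value `exp (-lam t₀) > 0` at order one.

For part (b), the same contour integral shows that `E_ρ(-z)` is bounded and Lipschitz in `z ≥ 0`.
Hence `E_ρ(-A(ξ) t₀ ^ ρ)` is a bounded continuous Fourier multiplier: it acts on `L₂`, and it
multiplies the value at a Lebesgue point by its own value there. So `U(t₀, ρ)` is `e_{lam₀}(ρ)`
times a positive constant. -/

/-! ### The half Hankel contour and the decay of `exp (exp w)` along it -/

/-- The angle of the ray of the Hankel contour. -/
def rayAngle : ℝ := 3 * Real.pi / 4

/-- Half of the Hankel contour integral in the logarithmic coordinate: the imaginary part of the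
integral of `g` over the segment from `x₀` to `x₀ + i rayAngle` followed by the horizontal ray
to the right. For `g` real on the real line this is `π` times the integral over the whole
contour, divided by `2 π i`. -/
def halfHankel (x₀ : ℝ) (g : ℂ → ℂ) : ℝ :=
  ((∫ x : ℝ in Ioi x₀, g (x + rayAngle * Complex.I)) +
    Complex.I * ∫ y : ℝ in (0 : ℝ)..rayAngle, g (x₀ + y * Complex.I)).im

/-- The closed strip between the real axis and the ray of the Hankel contour. -/
def hankelStrip : Set ℂ := {w | 0 ≤ w.im ∧ w.im ≤ rayAngle}

lemma rayAngle_pos : 0 < rayAngle := by unfold rayAngle; positivity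

lemma rayAngle_lt_pi : rayAngle < Real.pi := by unfold rayAngle; linarith [Real.pi_pos]

lemma cos_rayAngle : Real.cos rayAngle = -(√2 / 2) := by
  have : rayAngle = Real.pi - Real.pi / 4 := by unfold rayAngle; ring
  rw [this, Real.cos_pi_sub, Real.cos_pi_div_four]

lemma seven_tenths_le : (7 / 10 : ℝ) ≤ √2 / 2 := by
  have : (1.4 : ℝ) ≤ √2 := Real.le_sqrt_of_sq_le (by norm_num)
  linarith

lemma neg_le_cos_of_mem {y : ℝ} (h0 : 0 ≤ y) (h1 : y ≤ rayAngle) : -(√2 / 2) ≤ Real.cos y := by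
  rw [← cos_rayAngle]
  exact Real.cos_le_cos_of_nonneg_of_le_pi h0 rayAngle_lt_pi.le h1

lemma cos_le_of_mem {y : ℝ} (h0 : rayAngle ≤ y) (h1 : y ≤ Real.pi) :
    Real.cos y ≤ -(7 / 10) := by
  have := Real.cos_le_cos_of_nonneg_of_le_pi rayAngle_pos.le h1 h0
  rw [cos_rayAngle] at this
  linarith [seven_tenths_le]

lemma norm_exp_exp (x y : ℝ) :
    ‖Complex.exp (Complex.exp (x + y * Complex.I))‖ = Real.exp (Real.exp x * Real.cos y) := by
  rw [Complex.norm_exp, Complex.exp_re]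
  simp

lemma norm_exp_exp_ray_le {x y : ℝ} (h0 : rayAngle ≤ y) (h1 : y ≤ Real.pi) :
    ‖Complex.exp (Complex.exp (x + y * Complex.I))‖ ≤ Real.exp (-(7 / 10 * Real.exp x)) := by
  rw [norm_exp_exp, Real.exp_le_exp]
  nlinarith [cos_le_of_mem h0 h1, Real.exp_pos x]

lemma norm_exp_exp_le (x y : ℝ) :
    ‖Complex.exp (Complex.exp (x + y * Complex.I))‖ ≤ Real.exp (Real.exp x) := by
  rw [norm_exp_exp, Real.exp_le_exp]
  nlinarith [Real.cos_le_one y, Real.exp_pos x]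

lemma im_integral_eq_zero_of_im_eq_zero {g : ℂ → ℂ} (hg : ∀ x : ℝ, (g x).im = 0) (a b : ℝ) :
    (∫ x : ℝ in a..b, g x).im = 0 := by
  have : ∀ x : ℝ, g x = ((g x).re : ℂ) := fun x => Complex.ext (by simp) (by simp [hg x])
  rw [intervalIntegral.integral_congr (fun x _ => this x), intervalIntegral.integral_ofReal]
  simp

/-- The half Hankel integral does not depend on the abscissa of the vertical segment. -/
lemma halfHankel_shift {g : ℂ → ℂ} {x₀ x₁ : ℝ} (h : x₀ ≤ x₁)
    (hd : DifferentiableOn ℂ g hankelStrip) (hreal : ∀ x : ℝ, (g x).im = 0)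
    (hi : IntegrableOn (fun x : ℝ => g (x + rayAngle * Complex.I)) (Ioi x₀)) :
    halfHankel x₀ g = halfHankel x₁ g := by
  have hrect := Complex.integral_boundary_rect_eq_zero_of_differentiableOn g (x₀ : ℂ)
    (x₁ + rayAngle * Complex.I) (hd.mono (by
      intro w hw
      have := hw.2
      simp only [Complex.ofReal_im, Complex.add_im, Complex.mul_im, Complex.ofReal_re,
        Complex.I_im, mul_one, Complex.I_re, mul_zero, add_zero, zero_add, mem_preimage] at this
      rw [uIcc_of_le rayAngle_pos.le] at this
      exact this))
  have hsplit : (∫ x : ℝ in Ioi x₀, g (x + rayAngle * Complex.I)) =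
      (∫ x : ℝ in x₀..x₁, g (x + rayAngle * Complex.I)) +
        ∫ x : ℝ in Ioi x₁, g (x + rayAngle * Complex.I) := by
    rw [intervalIntegral.integral_of_le h, ← setIntegral_union (Ioc_disjoint_Ioi le_rfl)
      measurableSet_Ioi (hi.mono_set Ioc_subset_Ioi_self) (hi.mono_set (Ioi_subset_Ioi h)),
      Ioc_union_Ioi_eq_Ioi h]
  -- The bottom edge of the rectangle lies on the real axis, where `g` is real, so it drops out of
  -- the imaginary part of Cauchy's identity.
  have hre := im_integral_eq_zero_of_im_eq_zero hreal x₀ x₁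
  simp at hrect
  unfold halfHankel
  rw [hsplit]
  have := congrArg Complex.im hrect
  simp [hre] at this
  simp
  linarith

lemma hasDerivAt_neg_exp_exp {c : ℝ} (x : ℝ) :
    HasDerivAt (fun x => -Real.exp (-(c * Real.exp x)))
      (c * (Real.exp (-(c * Real.exp x)) * Real.exp x)) x := by
  have h := ((((Real.hasDerivAt_exp x).const_mul c).neg).exp).neg
  exact h.congr_deriv (by simp only [Pi.neg_apply]; ring)

lemma tendsto_exp_neg_exp {c : ℝ} (hc : 0 < c) :
    Tendsto (fun x => Real.exp (-(c * Real.exp x))) atTop (𝓝 0) :=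
  Real.tendsto_exp_neg_atTop_nhds_zero.comp (Real.tendsto_exp_atTop.const_mul_atTop hc)

lemma integrableOn_exp_neg_exp {c : ℝ} (hc : 0 < c) (x₀ : ℝ) :
    IntegrableOn (fun x => Real.exp (-(c * Real.exp x)) * Real.exp x) (Ioi x₀) := by
  have := integrableOn_Ioi_deriv_of_nonneg' (a := x₀) (l := -0)
    (fun x _ => hasDerivAt_neg_exp_exp (c := c) x)
    (fun x _ => by positivity) (tendsto_exp_neg_exp hc).neg
  refine (this.const_mul c⁻¹).congr (Eventually.of_forall fun x => ?_)
  simp only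
  field_simp

/-- An integrand dominated by `e ^ x` times a constant apart from the factor `exp (exp w)` is
integrable along the rays of the contour. -/
lemma integrableOn_ray_of_bound {h : ℝ → ℂ} (hc : Continuous h) {x₀ C y : ℝ}
    (h0 : rayAngle ≤ y) (h1 : y ≤ Real.pi) (hb : ∀ x, x₀ < x → ‖h x‖ ≤ C * Real.exp x) :
    IntegrableOn (fun x : ℝ => Complex.exp (Complex.exp (x + y * Complex.I)) * h x) (Ioi x₀) := by
  refine Integrable.mono' ((integrableOn_exp_neg_exp (by norm_num : (0:ℝ) < 7 / 10) x₀).const_mul C)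
    (Continuous.aestronglyMeasurable (by fun_prop)) ?_
  refine (ae_restrict_iff' measurableSet_Ioi).2 (Eventually.of_forall fun x hx => ?_)
  rw [norm_mul]
  calc _ ≤ Real.exp (-(7 / 10 * Real.exp x)) * (C * Real.exp x) := by
        gcongr
        · exact norm_exp_exp_ray_le h0 h1
        · exact hb x hx
    _ = _ := by ring

/-! ### Hankel's formula for the reciprocal Gamma function -/

/-- The integrand `exp (e ^ w - a w)` of the Hankel integral for `1 / Γ(a + 1)`. -/
def hankelKernel (a : ℝ) (w : ℂ) : ℂ := Complex.exp (Complex.exp w) * Complex.exp (-(a * w))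

lemma differentiable_hankelKernel (a : ℝ) : Differentiable ℂ (hankelKernel a) := by
  unfold hankelKernel; fun_prop

lemma hankelKernel_ofReal_im (a x : ℝ) : (hankelKernel a x).im = 0 := by
  unfold hankelKernel
  have : Complex.exp (Complex.exp x) * Complex.exp (-(a * x)) =
      ((Real.exp (Real.exp x) * Real.exp (-(a * x)) : ℝ) : ℂ) := by push_cast; rfl
  rw [this, Complex.ofReal_im]

lemma norm_exp_neg_mul (a x y : ℝ) :
    ‖Complex.exp (-(a * (x + y * Complex.I)))‖ = Real.exp (-(a * x)) := by
  rw [Complex.norm_exp]; simp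

lemma integrableOn_hankelKernel {a : ℝ} (ha : -1 ≤ a) (x₀ : ℝ) {y : ℝ} (h0 : rayAngle ≤ y)
    (h1 : y ≤ Real.pi) :
    IntegrableOn (fun x : ℝ => hankelKernel a (x + y * Complex.I)) (Ioi x₀) := by
  refine integrableOn_ray_of_bound (C := Real.exp (-((a + 1) * x₀))) (by fun_prop) h0 h1 ?_
  intro x hx
  rw [norm_exp_neg_mul, ← Real.exp_add, Real.exp_le_exp]
  nlinarith

lemma halfHankel_hankelKernel_eq {a : ℝ} (ha : -1 ≤ a) {x₀ x₁ : ℝ} (h : x₀ ≤ x₁) :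
    halfHankel x₀ (hankelKernel a) = halfHankel x₁ (hankelKernel a) :=
  halfHankel_shift h (differentiable_hankelKernel a).differentiableOn (hankelKernel_ofReal_im a)
    (integrableOn_hankelKernel ha x₀ le_rfl rayAngle_lt_pi.le)

lemma norm_hankelKernel_le_of_nonpos (a : ℝ) {x : ℝ} (hx : x ≤ 0) (y : ℝ) :
    ‖hankelKernel a (x + y * Complex.I)‖ ≤ Real.exp 1 * Real.exp (-a * x) := by
  unfold hankelKernel
  rw [norm_mul, norm_exp_neg_mul, neg_mul]
  gcongr
  refine (norm_exp_exp_le x y).trans ?_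
  rw [Real.exp_le_exp]
  exact Real.exp_le_one_iff.2 hx

lemma norm_hankelKernel_le_of_nonneg {a : ℝ} (ha : -1 ≤ a) {x y : ℝ} (hx : 0 ≤ x)
    (h0 : rayAngle ≤ y) (h1 : y ≤ Real.pi) :
    ‖hankelKernel a (x + y * Complex.I)‖ ≤ Real.exp (-(7 / 10 * Real.exp x)) * Real.exp x := by
  unfold hankelKernel
  rw [norm_mul, norm_exp_neg_mul]
  gcongr
  · exact norm_exp_exp_ray_le h0 h1
  · nlinarith

lemma integrable_hankelKernel {a : ℝ} (ha : -1 ≤ a) (ha' : a < 0) {y : ℝ} (h0 : rayAngle ≤ y)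
    (h1 : y ≤ Real.pi) : Integrable (fun x : ℝ => hankelKernel a (x + y * Complex.I)) := by
  rw [← integrableOn_univ, ← Iic_union_Ioi (a := (0 : ℝ))]
  refine IntegrableOn.union ?_ (integrableOn_hankelKernel ha 0 h0 h1)
  have hbound : IntegrableOn (fun x => Real.exp 1 * Real.exp (-a * x)) (Iic 0) :=
    (integrableOn_exp_mul_Iic (neg_pos.2 ha') 0).const_mul _
  refine Integrable.mono' hbound (Continuous.aestronglyMeasurable ?_) ?_
  · exact (differentiable_hankelKernel a).continuous.comp (by fun_prop)
  · exact (ae_restrict_iff' measurableSet_Iic).2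
      (Eventually.of_forall fun x hx => norm_hankelKernel_le_of_nonpos a hx y)

lemma tendsto_vertical_hankelKernel {a : ℝ} (ha : a < 0) (b c : ℝ) :
    Tendsto (fun R : ℝ => ∫ y : ℝ in b..c, hankelKernel a ((-R : ℝ) + y * Complex.I)) atTop
      (𝓝 0) := by
  have hz : Tendsto (fun R : ℝ => Real.exp 1 * Real.exp (-(-a * R)) * |c - b|) atTop (𝓝 0) := by
    have : Tendsto (fun R : ℝ => Real.exp (-(-a * R))) atTop (𝓝 0) :=
      Real.tendsto_exp_neg_atTop_nhds_zero.comp (tendsto_id.const_mul_atTop (neg_pos.2 ha))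
    simpa using (this.const_mul (Real.exp 1)).mul_const |c - b|
  refine squeeze_zero_norm' ?_ hz
  filter_upwards [eventually_ge_atTop 0] with R hR
  refine intervalIntegral.norm_integral_le_of_norm_le_const fun y _ => ?_
  refine (norm_hankelKernel_le_of_nonpos a (neg_nonpos.2 hR) y).trans (le_of_eq ?_)
  ring_nf

lemma tendsto_vertical_hankelKernel_right {a : ℝ} (ha : -1 ≤ a) :
    Tendsto (fun R : ℝ => ∫ y : ℝ in rayAngle..Real.pi, hankelKernel a (R + y * Complex.I)) atTop
      (𝓝 0) := by
  have hz : Tendsto (fun R : ℝ => Real.exp (-(7 / 10 * Real.exp R)) * Real.exp R *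
      |Real.pi - rayAngle|) atTop (𝓝 0) := by
    have h1 : Tendsto (fun u : ℝ => u ^ (1 : ℝ) * Real.exp (-(7 / 10) * u)) atTop (𝓝 0) :=
      tendsto_rpow_mul_exp_neg_mul_atTop_nhds_zero 1 _ (by norm_num)
    have h2 := (h1.comp Real.tendsto_exp_atTop).mul_const |Real.pi - rayAngle|
    simp only [zero_mul] at h2
    refine h2.congr fun R => ?_
    simp only [Function.comp, Real.rpow_one]
    ring_nf
  refine squeeze_zero_norm' ?_ hz
  filter_upwards [eventually_ge_atTop 0] with R hR
  refine intervalIntegral.norm_integral_le_of_norm_le_const fun y hy => ?_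
  rw [uIoc_of_le rayAngle_lt_pi.le] at hy
  exact norm_hankelKernel_le_of_nonneg ha hR hy.1.le hy.2

/-- Cauchy's theorem on `[-R, R] × [rayAngle, π]`: the left side vanishes in the limit because `a <
0`, the right side because `exp (e ^ w)` decays doubly exponentially there. -/
lemma integral_hankelKernel_rotate {a : ℝ} (ha : -1 ≤ a) (ha' : a < 0) :
    ∫ x : ℝ, hankelKernel a (x + rayAngle * Complex.I) =
      ∫ x : ℝ, hankelKernel a (x + Real.pi * Complex.I) := by
  have hrect : ∀ R : ℝ, (∫ x : ℝ in -R..R, hankelKernel a (x + rayAngle * Complex.I)) -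
      (∫ x : ℝ in -R..R, hankelKernel a (x + Real.pi * Complex.I)) +
      Complex.I * (∫ y : ℝ in rayAngle..Real.pi, hankelKernel a (R + y * Complex.I)) -
      Complex.I * (∫ y : ℝ in rayAngle..Real.pi, hankelKernel a ((-R : ℝ) + y * Complex.I)) =
      0 := by
    intro R
    have := Complex.integral_boundary_rect_eq_zero_of_differentiableOn (hankelKernel a)
      (((-R : ℝ) : ℂ) + rayAngle * Complex.I) (R + Real.pi * Complex.I)
      (differentiable_hankelKernel a).differentiableOn
    simpa using this
  have ht (y : ℝ) (h0 : rayAngle ≤ y) (h1 : y ≤ Real.pi) :=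
    intervalIntegral_tendsto_integral (integrable_hankelKernel ha ha' h0 h1)
      tendsto_neg_atTop_atBot tendsto_id
  have hlim := (((ht _ le_rfl rayAngle_lt_pi.le).sub (ht _ rayAngle_lt_pi.le le_rfl)).add
    ((tendsto_vertical_hankelKernel_right ha).const_mul Complex.I)).sub
    ((tendsto_vertical_hankelKernel ha' rayAngle Real.pi).const_mul Complex.I)
  simp only [id] at hlim
  rw [tendsto_congr hrect] at hlim
  have := tendsto_nhds_unique hlim tendsto_const_nhds
  rw [mul_zero, add_zero, sub_zero] at this
  exact sub_eq_zero.1 this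

lemma integral_exp_neg_exp_mul (a : ℝ) (ha : a < 0) :
    ∫ x : ℝ, Real.exp (-Real.exp x) * Real.exp (-(a * x)) = Real.Gamma (-a) := by
  rw [Real.Gamma_eq_integral (neg_pos.2 ha), ← Real.range_exp, ← image_univ,
    integral_image_eq_integral_abs_deriv_smul MeasurableSet.univ
      (fun x _ => (Real.hasDerivAt_exp x).hasDerivWithinAt) Real.exp_injective.injOn,
    setIntegral_univ]
  congr 1 with x
  rw [abs_of_pos (Real.exp_pos x), smul_eq_mul, Real.rpow_sub (Real.exp_pos x), Real.rpow_one,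
    ← Real.exp_mul]
  field_simp

lemma integral_hankelKernel_pi {a : ℝ} (ha : a < 0) :
    ∫ x : ℝ, hankelKernel a (x + Real.pi * Complex.I) =
      Real.Gamma (-a) * Complex.exp (-(a * (Real.pi * Complex.I))) := by
  rw [← integral_exp_neg_exp_mul a ha, ← integral_complex_ofReal, ← integral_mul_const]
  congr 1 with x
  unfold hankelKernel
  rw [Complex.exp_add, Complex.exp_pi_mul_I, mul_add, neg_add, Complex.exp_add]
  push_cast
  rw [mul_neg_one]
  ring

/-- For `a < 0` the vertical segment can be moved to `-∞`, which leaves a full horizontal line.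
Raised to height `π`, where `e ^ w = -e ^ x`, it becomes Euler's integral for `Γ(-a)` times a phase;
Euler's reflection formula finishes. -/
lemma halfHankel_hankelKernel_of_neg {a : ℝ} (ha : -1 ≤ a) (ha' : a < 0) :
    halfHankel 0 (hankelKernel a) = Real.pi / Real.Gamma (a + 1) := by
  have hlim : Tendsto (fun R : ℝ => halfHankel (-R) (hankelKernel a)) atTop
      (𝓝 (∫ x : ℝ, hankelKernel a (x + rayAngle * Complex.I)).im) := by
    have h1 : Tendsto (fun R : ℝ => ∫ x : ℝ in Ioi (-R),
        hankelKernel a (x + rayAngle * Complex.I)) atTop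
        (𝓝 (∫ x : ℝ, hankelKernel a (x + rayAngle * Complex.I))) :=
      (aecover_Ioi tendsto_neg_atTop_atBot).integral_tendsto_of_countably_generated
        (integrable_hankelKernel ha ha' le_rfl rayAngle_lt_pi.le)
    have h2 := (tendsto_vertical_hankelKernel ha' 0 rayAngle).const_mul Complex.I
    have h3 := h1.add h2
    rw [mul_zero, add_zero] at h3
    exact (Complex.continuous_im.tendsto _).comp h3
  have hconst : ∀ᶠ R : ℝ in atTop, halfHankel (-R) (hankelKernel a) =
      halfHankel 0 (hankelKernel a) := by
    filter_upwards [eventually_ge_atTop 0] with R hR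
    exact halfHankel_hankelKernel_eq ha (neg_nonpos.2 hR)
  rw [tendsto_congr' hconst] at hlim
  rw [tendsto_nhds_unique tendsto_const_nhds hlim, integral_hankelKernel_rotate ha ha',
    integral_hankelKernel_pi ha']
  have hexp : Complex.exp (-(a * (Real.pi * Complex.I))) =
      Complex.exp (((-(a * Real.pi) : ℝ) : ℂ) * Complex.I) := by
    congr 1; push_cast; ring
  rw [hexp, Complex.im_ofReal_mul, Complex.exp_ofReal_mul_I_im]
  have hrefl := Real.Gamma_mul_Gamma_one_sub (-a)
  rw [sub_neg_eq_add, add_comm] at hrefl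
  -- At `a = -1` both sides vanish: `sin π = 0` on the left, and on the right `Γ(0)` takes the
  -- default value `0`, so the quotient is `0`, as `1 / Γ` should be at its zero.
  rcases ha.eq_or_lt with rfl | h
  · simp
  · have hs : 0 < Real.sin (Real.pi * -a) :=
      Real.sin_pos_of_pos_of_lt_pi (by nlinarith [Real.pi_pos]) (by nlinarith [Real.pi_pos])
    have hg : 0 < Real.Gamma (a + 1) := Real.Gamma_pos_of_pos (by linarith)
    have h2 : -(a * Real.pi) = Real.pi * -a := by ring
    rw [h2, eq_div_iff hg.ne']
    linarith [(eq_div_iff hs.ne').1 hrefl]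

lemma continuousAt_halfHankel_hankelKernel :
    ContinuousAt (fun a => halfHankel 0 (hankelKernel a)) 0 := by
  have h1 : ContinuousAt (fun a => ∫ x : ℝ in Ioi 0, hankelKernel a (x + rayAngle * Complex.I))
      0 := by
    refine continuousAt_of_dominated
      (bound := fun x => Real.exp (-(7 / 10 * Real.exp x)) * Real.exp x) ?_ ?_ ?_ ?_
    · refine Eventually.of_forall fun a => Continuous.aestronglyMeasurable ?_
      exact (differentiable_hankelKernel a).continuous.comp (by fun_prop)
    · filter_upwards [Ioi_mem_nhds (show (-1 : ℝ) < 0 by norm_num)] with a ha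
      refine (ae_restrict_iff' measurableSet_Ioi).2 (Eventually.of_forall fun x hx => ?_)
      exact norm_hankelKernel_le_of_nonneg (mem_Ioi.1 ha).le (mem_Ioi.1 hx).le le_rfl
        rayAngle_lt_pi.le
    · exact integrableOn_exp_neg_exp (by norm_num) 0
    · refine Eventually.of_forall fun x => ?_
      unfold hankelKernel
      fun_prop
  have h2 : Continuous (fun a : ℝ => ∫ y : ℝ in (0 : ℝ)..rayAngle,
      hankelKernel a ((0 : ℝ) + y * Complex.I)) := by
    apply intervalIntegral.continuous_parametric_intervalIntegral_of_continuous'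
    unfold hankelKernel
    fun_prop
  exact Complex.continuous_im.continuousAt.comp
    (h1.add (continuousAt_const.mul h2.continuousAt))

/-- The argument for `a < 0` needs decay at `-∞`, which fails at `a = 0`; this value is reached by
continuity from the left. -/
lemma halfHankel_hankelKernel_zero : halfHankel 0 (hankelKernel 0) = Real.pi := by
  have h1 : Tendsto (fun a => halfHankel 0 (hankelKernel a)) (𝓝[<] 0)
      (𝓝 (halfHankel 0 (hankelKernel 0))) :=
    continuousAt_halfHankel_hankelKernel.tendsto.mono_left nhdsWithin_le_nhds
  have h2 : Tendsto (fun a : ℝ => Real.pi / Real.Gamma (a + 1)) (𝓝[<] 0) (𝓝 Real.pi) := by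
    have hc : ContinuousAt (fun a : ℝ => Real.pi / Real.Gamma (a + 1)) 0 := by
      have hg : ContinuousAt Real.Gamma ((0 : ℝ) + 1) :=
        (Real.differentiableAt_Gamma fun m =>
          ne_of_gt (by linarith [m.cast_nonneg (α := ℝ)])).continuousAt
      refine continuousAt_const.div (hg.comp (f := fun a : ℝ => a + 1) (by fun_prop)) ?_
      simp [Real.Gamma_one]
    have := hc.tendsto
    simp only [zero_add, Real.Gamma_one, div_one] at this
    exact this.mono_left nhdsWithin_le_nhds
  refine tendsto_nhds_unique h1 (h2.congr' ?_)
  have : Ioo (-1 : ℝ) 0 ∈ 𝓝[<] (0 : ℝ) := Ioo_mem_nhdsLT (by norm_num)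
  filter_upwards [this] with a ha
  exact (halfHankel_hankelKernel_of_neg ha.1.le ha.2).symm

lemma hasDerivAt_hankelKernel (a : ℝ) (w : ℂ) :
    HasDerivAt (hankelKernel a) (hankelKernel (a - 1) w - a * hankelKernel a w) w := by
  unfold hankelKernel
  have h1 := (Complex.hasDerivAt_exp w).cexp
  have h2 := (((hasDerivAt_id w).const_mul (a : ℂ)).neg).cexp
  refine (h1.mul h2).congr_deriv ?_
  have : Complex.exp (-(((a - 1 : ℝ) : ℂ) * w)) = Complex.exp w * Complex.exp (-(a * w)) := by
    rw [← Complex.exp_add]; congr 1; push_cast; ring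
  rw [this]
  simp only [Pi.neg_apply, id]
  ring

/-- The difference of the two kernels is the derivative of `hankelKernel a`, so its contour integral
reduces to an endpoint value on the real axis, which has no imaginary part. This mirrors `Γ(a + 1) =
a Γ(a)` and carries Hankel's formula to positive `a`. -/
lemma halfHankel_hankelKernel_sub_one {a : ℝ} (ha : 0 ≤ a) :
    halfHankel 0 (hankelKernel (a - 1)) = a * halfHankel 0 (hankelKernel a) := by
  have hi1 := integrableOn_hankelKernel (a := a - 1) (by linarith) 0 le_rfl rayAngle_lt_pi.le
  have hi2 := (integrableOn_hankelKernel (a := a) (by linarith) 0 le_rfl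
    rayAngle_lt_pi.le).const_mul (a : ℂ)
  have hray : ∫ x : ℝ in Ioi 0, (hankelKernel (a - 1) (x + rayAngle * Complex.I) -
      a * hankelKernel a (x + rayAngle * Complex.I)) =
      0 - hankelKernel a ((0 : ℝ) + rayAngle * Complex.I) := by
    refine integral_Ioi_of_hasDerivAt_of_tendsto'
      (f := fun x : ℝ => hankelKernel a (x + rayAngle * Complex.I)) (fun x _ => ?_)
      (hi1.sub hi2) ?_
    · exact ((hasDerivAt_hankelKernel a (x + rayAngle * Complex.I)).comp_add_const _ _).comp_ofReal
    · refine squeeze_zero_norm' ?_ (tendsto_exp_neg_exp (by norm_num : (0:ℝ) < 7 / 10))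
      filter_upwards [eventually_ge_atTop 0] with x hx
      unfold hankelKernel
      rw [norm_mul, norm_exp_neg_mul]
      refine (mul_le_of_le_one_right (norm_nonneg _) ?_).trans
        (norm_exp_exp_ray_le le_rfl rayAngle_lt_pi.le)
      exact Real.exp_le_one_iff.2 (by nlinarith)
  have hc (b : ℝ) : Continuous fun y : ℝ => hankelKernel b ((0 : ℝ) + y * Complex.I) :=
    (differentiable_hankelKernel b).continuous.comp (by fun_prop)
  have hseg : ∫ y : ℝ in (0 : ℝ)..rayAngle, (hankelKernel (a - 1) ((0 : ℝ) + y * Complex.I) -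
      a * hankelKernel a ((0 : ℝ) + y * Complex.I)) * Complex.I =
      hankelKernel a ((0 : ℝ) + rayAngle * Complex.I) -
        hankelKernel a ((0 : ℝ) + (0 : ℝ) * Complex.I) := by
    refine intervalIntegral.integral_eq_sub_of_hasDerivAt
      (f := fun y : ℝ => hankelKernel a ((0 : ℝ) + y * Complex.I)) (fun y _ => ?_) ?_
    · have hl : HasDerivAt (fun z : ℂ => ((0 : ℝ) : ℂ) + z * Complex.I) Complex.I y := by
        simpa using ((hasDerivAt_id (y : ℂ)).mul_const Complex.I).const_add ((0 : ℝ) : ℂ)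
      exact ((hasDerivAt_hankelKernel a ((0 : ℝ) + y * Complex.I)).comp (y : ℂ) hl).comp_ofReal
    · exact Continuous.intervalIntegrable
        (((hc _).sub (continuous_const.mul (hc _))).mul continuous_const) _ _
  have hc' : Continuous fun y : ℝ => a * hankelKernel a ((0 : ℝ) + y * Complex.I) :=
    continuous_const.mul (hc a)
  rw [intervalIntegral.integral_mul_const, intervalIntegral.integral_sub
    ((hc _).intervalIntegrable _ _) (hc'.intervalIntegrable _ _),
    intervalIntegral.integral_const_mul] at hseg
  rw [integral_sub hi1 hi2, integral_const_mul] at hray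
  have h0 : (hankelKernel a ((0 : ℝ) + (0 : ℝ) * Complex.I)).im = 0 := by
    rw [Complex.ofReal_zero, zero_mul, add_zero, ← Complex.ofReal_zero]
    exact hankelKernel_ofReal_im a 0
  have := congrArg Complex.im (congrArg₂ (· + ·) hray hseg)
  unfold halfHankel
  simp only [Complex.add_im, Complex.sub_im, Complex.mul_im, Complex.I_re, Complex.I_im,
    Complex.zero_im, h0, Complex.sub_re, Complex.mul_re, Complex.ofReal_re,
    Complex.ofReal_im] at this ⊢
  linarith

/-- **Hankel's formula** for the reciprocal Gamma function. -/
theorem halfHankel_hankelKernel {a : ℝ} (ha : -1 ≤ a) {x₀ : ℝ} (hx₀ : 0 ≤ x₀) :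
    halfHankel x₀ (hankelKernel a) = Real.pi / Real.Gamma (a + 1) := by
  rw [← halfHankel_hankelKernel_eq ha hx₀]
  obtain ⟨n, hn⟩ := exists_nat_ge a
  induction n generalizing a with
  | zero =>
    rcases (show a ≤ 0 by simpa using hn).eq_or_lt with rfl | h
    · simp [halfHankel_hankelKernel_zero]
    · exact halfHankel_hankelKernel_of_neg ha h
  | succ n ih =>
    rcases le_or_gt a 0 with h | h
    · exact ih ha (h.trans (Nat.cast_nonneg n))
    · have h1 := ih (a := a - 1) (by linarith) (by push_cast at hn; linarith)
      rw [halfHankel_hankelKernel_sub_one h.le, sub_add_cancel] at h1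
      rw [Real.Gamma_add_one h.ne']
      field_simp at h1 ⊢
      linarith

/-! ### The contour integral for the Mittag-Leffler function -/

/-- The integrand `exp (e ^ w) / (1 + z e ^ (-ρ w))` of the contour integral for the
Mittag-Leffler function. -/
def mittagLefflerKernel (ρ z : ℝ) (w : ℂ) : ℂ :=
  Complex.exp (Complex.exp w) / (1 + z * Complex.exp (-(ρ * w)))

/-- The squared norm is at least `1 - √2 r + r ^ 2`, which equals both `(r - √2 / 2) ^ 2 + 1 / 2`
and `(1 - r √2 / 2) ^ 2 + r ^ 2 / 2`. The angle `3π / 4` thus serves two ends: its cosine is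
negative, and `1 + q` stays away from zero for all orders up to one. -/
lemma half_le_normSq_one_add {r θ : ℝ} (hr : 0 ≤ r) (hθ : -(√2 / 2) ≤ Real.cos θ) :
    1 / 2 ≤ ‖1 + r * Complex.exp (θ * Complex.I)‖ ^ 2 ∧
      r ^ 2 / 2 ≤ ‖1 + r * Complex.exp (θ * Complex.I)‖ ^ 2 := by
  have h2 : √2 ^ 2 = 2 := Real.sq_sqrt (by norm_num)
  have hn : ‖1 + r * Complex.exp (θ * Complex.I)‖ ^ 2 = 1 + 2 * r * Real.cos θ + r ^ 2 := by
    rw [← Complex.normSq_eq_norm_sq, Complex.normSq_apply, Complex.exp_mul_I]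
    simp [← Complex.ofReal_cos, ← Complex.ofReal_sin]
    linear_combination r ^ 2 * Real.sin_sq_add_cos_sq θ
  have h3 := mul_le_mul_of_nonneg_left hθ hr
  rw [hn]
  constructor
  · nlinarith [sq_nonneg (r - √2 / 2)]
  · nlinarith [sq_nonneg (1 - r * (√2 / 2))]

lemma ofReal_mul_exp_neg_mul (ρ z x y : ℝ) :
    z * Complex.exp (-(ρ * (x + y * Complex.I))) =
      ((z * Real.exp (-(ρ * x)) : ℝ) : ℂ) * Complex.exp (((-(ρ * y) : ℝ) : ℂ) * Complex.I) := by
  push_cast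
  rw [mul_assoc, ← Complex.exp_add]
  congr 2
  ring

lemma norm_ofReal_mul_exp_neg_mul {z : ℝ} (hz : 0 ≤ z) (ρ x y : ℝ) :
    ‖z * Complex.exp (-(ρ * (x + y * Complex.I)))‖ = z * Real.exp (-(ρ * x)) := by
  rw [norm_mul, norm_exp_neg_mul, Complex.norm_real, Real.norm_of_nonneg hz]

/-- On the strip the denominator `1 + q` stays away from zero, also relative to `q`. -/
lemma normSq_one_add_ge {ρ z x y : ℝ} (hρ : ρ ∈ Icc (0 : ℝ) 1) (hz : 0 ≤ z) (h0 : 0 ≤ y)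
    (h1 : y ≤ rayAngle) :
    1 / 2 ≤ ‖1 + z * Complex.exp (-(ρ * (x + y * Complex.I)))‖ ^ 2 ∧
      ‖z * Complex.exp (-(ρ * (x + y * Complex.I)))‖ ^ 2 / 2 ≤
        ‖1 + z * Complex.exp (-(ρ * (x + y * Complex.I)))‖ ^ 2 := by
  rw [norm_ofReal_mul_exp_neg_mul hz, ofReal_mul_exp_neg_mul]
  refine half_le_normSq_one_add (by positivity) ?_
  rw [Real.cos_neg]
  exact neg_le_cos_of_mem (mul_nonneg hρ.1 h0) ((mul_le_of_le_one_left h0 hρ.2).trans h1)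

lemma one_add_ne_zero {ρ z x y : ℝ} (hρ : ρ ∈ Icc (0 : ℝ) 1) (hz : 0 ≤ z) (h0 : 0 ≤ y)
    (h1 : y ≤ rayAngle) : 1 + z * Complex.exp (-(ρ * (x + y * Complex.I))) ≠ 0 := by
  intro h
  have := (normSq_one_add_ge (x := x) hρ hz h0 h1).1
  rw [h] at this
  norm_num at this

lemma norm_inv_one_add_le {ρ z x y : ℝ} (hρ : ρ ∈ Icc (0 : ℝ) 1) (hz : 0 ≤ z) (h0 : 0 ≤ y)
    (h1 : y ≤ rayAngle) :
    ‖(1 + z * Complex.exp (-(ρ * (x + y * Complex.I))))⁻¹‖ ≤ √2 := by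
  rw [norm_inv]
  have h := (normSq_one_add_ge (x := x) hρ hz h0 h1).1
  have hpos : 0 < ‖1 + z * Complex.exp (-(ρ * (x + y * Complex.I)))‖ :=
    norm_pos_iff.2 (one_add_ne_zero hρ hz h0 h1)
  refine Real.le_sqrt_of_sq_le ?_
  rw [inv_pow]
  exact inv_le_of_inv_le₀ (by norm_num) (by linarith)

lemma differentiableOn_mittagLefflerKernel {ρ z : ℝ} (hρ : ρ ∈ Icc (0 : ℝ) 1) (hz : 0 ≤ z) :
    DifferentiableOn ℂ (mittagLefflerKernel ρ z) hankelStrip := by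
  intro w hw
  unfold mittagLefflerKernel
  have h1 : Differentiable ℂ fun w => Complex.exp (Complex.exp w) := by fun_prop
  have h2 : Differentiable ℂ fun w => 1 + z * Complex.exp (-(ρ * w)) := by fun_prop
  refine (h1 w).differentiableWithinAt.div (h2 w).differentiableWithinAt ?_
  have := one_add_ne_zero (x := w.re) hρ hz hw.1 hw.2
  rwa [Complex.re_add_im] at this

lemma mittagLefflerKernel_ofReal_im (ρ z x : ℝ) : (mittagLefflerKernel ρ z x).im = 0 := by
  have : mittagLefflerKernel ρ z x =
      ((Real.exp (Real.exp x) / (1 + z * Real.exp (-(ρ * x))) : ℝ) : ℂ) := by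
    unfold mittagLefflerKernel; push_cast; rfl
  rw [this, Complex.ofReal_im]

lemma continuous_ray_one_add (ρ z y : ℝ) :
    Continuous fun x : ℝ => 1 + z * Complex.exp (-(ρ * (x + y * Complex.I))) := by fun_prop

lemma integrableOn_mittagLefflerKernel {ρ z : ℝ} (hρ : ρ ∈ Icc (0 : ℝ) 1) (hz : 0 ≤ z)
    {x₀ : ℝ} (hx₀ : 0 ≤ x₀) :
    IntegrableOn (fun x : ℝ => mittagLefflerKernel ρ z (x + rayAngle * Complex.I)) (Ioi x₀) := by
  unfold mittagLefflerKernel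
  simp_rw [div_eq_mul_inv]
  refine integrableOn_ray_of_bound (C := √2) ?_ le_rfl rayAngle_lt_pi.le ?_
  · exact (continuous_ray_one_add ρ z rayAngle).inv₀
      fun x => one_add_ne_zero hρ hz rayAngle_pos.le le_rfl
  · intro x hx
    refine (norm_inv_one_add_le hρ hz rayAngle_pos.le le_rfl).trans ?_
    exact le_mul_of_one_le_right (by positivity) (Real.one_le_exp (hx₀.trans hx.le))

lemma hasSum_integral_mul_neg_pow {μ : Measure ℝ} {h q : ℝ → ℂ} (hh : Integrable h μ)
    (hq : Continuous q) {θ : ℝ} (hθ : 0 ≤ θ) (hθ1 : θ < 1) (hqθ : ∀ᵐ x ∂μ, ‖q x‖ ≤ θ) :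
    HasSum (fun k : ℕ => ∫ x, h x * (-q x) ^ k ∂μ) (∫ x, h x / (1 + q x) ∂μ) := by
  refine hasSum_integral_of_dominated_convergence (fun k x => ‖h x‖ * θ ^ k) ?_ ?_ ?_ ?_ ?_
  · exact fun k => hh.aestronglyMeasurable.mul (hq.neg.pow k).aestronglyMeasurable
  · intro k
    filter_upwards [hqθ] with x hx
    rw [norm_mul, norm_pow, norm_neg]
    gcongr
  · exact Eventually.of_forall fun x => (summable_geometric_of_lt_one hθ hθ1).mul_left _
  · simp_rw [tsum_mul_left]
    exact hh.norm.mul_const _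
  · filter_upwards [hqθ] with x hx
    have := (hasSum_geometric_of_norm_lt_one (ξ := -q x)
      (by rw [norm_neg]; exact hx.trans_lt hθ1)).mul_left (h x)
    rwa [sub_neg_eq_add, ← div_eq_mul_inv] at this

lemma neg_pow_mul_hankelKernel (ρ z : ℝ) (k : ℕ) (w : ℂ) :
    Complex.exp (Complex.exp w) * (-(z * Complex.exp (-(ρ * w)))) ^ k =
      (((-z) ^ k : ℝ) : ℂ) * hankelKernel (ρ * k) w := by
  unfold hankelKernel
  have : Complex.exp (-(((ρ * k : ℝ) : ℂ) * w)) = Complex.exp (-(ρ * w)) ^ k := by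
    rw [← Complex.exp_nat_mul]; congr 1; push_cast; ring
  rw [this, ← neg_mul, mul_pow]
  push_cast
  ring

lemma halfHankel_ofReal_mul (x₀ c : ℝ) (g : ℂ → ℂ) :
    halfHankel x₀ (fun w => c * g w) = c * halfHankel x₀ g := by
  unfold halfHankel
  rw [integral_const_mul, intervalIntegral.integral_const_mul]
  simp only [Complex.add_im, Complex.mul_im, Complex.I_re, Complex.I_im, Complex.mul_re,
    Complex.ofReal_re, Complex.ofReal_im]
  ring

/-- The condition on `x₀` makes `‖q‖` at most a constant below one on the whole contour, so `1 / (1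
+ q)` expands geometrically and dominated convergence applies. -/
lemma hasSum_halfHankel_mittagLefflerKernel {ρ z x₀ : ℝ} (hρ : 0 < ρ) (hz : 0 ≤ z)
    (hθ : z * Real.exp (-(ρ * x₀)) < 1) (hx₀ : 0 ≤ x₀) :
    HasSum (fun k : ℕ => (-z) ^ k * halfHankel x₀ (hankelKernel (ρ * k)))
      (halfHankel x₀ (mittagLefflerKernel ρ z)) := by
  have hray : Integrable (fun x : ℝ => Complex.exp (Complex.exp (x + rayAngle * Complex.I)))
      (volume.restrict (Ioi x₀)) := by
    rw [← IntegrableOn]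
    simpa using (integrableOn_ray_of_bound (h := fun _ => 1) (C := 1) (x₀ := x₀) continuous_const
      le_rfl rayAngle_lt_pi.le
      (fun x hx => by simpa using Real.one_le_exp (hx₀.trans hx.le)))
  have h1 := hasSum_integral_mul_neg_pow hray
    (q := fun x : ℝ => z * Complex.exp (-(ρ * (x + rayAngle * Complex.I)))) (by fun_prop)
    (by positivity) hθ ((ae_restrict_iff' measurableSet_Ioi).2 (Eventually.of_forall fun x hx => by
      rw [norm_ofReal_mul_exp_neg_mul hz]
      gcongr
      exact (mem_Ioi.1 hx).le))
  have hseg : Integrable (fun y : ℝ => Complex.exp (Complex.exp (x₀ + y * Complex.I)))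
      (volume.restrict (Ioc 0 rayAngle)) :=
    (Continuous.integrableOn_Icc (by fun_prop)).mono_set Ioc_subset_Icc_self
  have h2 := hasSum_integral_mul_neg_pow hseg
    (q := fun y : ℝ => z * Complex.exp (-(ρ * (x₀ + y * Complex.I)))) (by fun_prop)
    (by positivity) hθ (Eventually.of_forall fun y => by rw [norm_ofReal_mul_exp_neg_mul hz])
  have h3 := Complex.hasSum_im (h1.add (h2.mul_left Complex.I))
  convert h3 using 1
  · ext k
    rw [← halfHankel_ofReal_mul, halfHankel, intervalIntegral.integral_of_le rayAngle_pos.le]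
    simp_rw [neg_pow_mul_hankelKernel]
  · rw [halfHankel, intervalIntegral.integral_of_le rayAngle_pos.le]
    rfl

/-- The Hankel contour representation of the Mittag-Leffler function on the negative half-line. -/
theorem halfHankel_mittagLefflerKernel {ρ z : ℝ} (hρ : ρ ∈ Ioc (0 : ℝ) 1) (hz : 0 ≤ z) :
    halfHankel 0 (mittagLefflerKernel ρ z) = Real.pi * mittagLeffler ρ (-z) := by
  have hρ' : ρ ∈ Icc (0 : ℝ) 1 := ⟨hρ.1.le, hρ.2⟩
  -- At abscissa `0` one has `‖q‖ = z`, possibly large. The segment is moved right until the series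
  -- converges; no pole is crossed because `1 + q` has no zero in the strip.
  obtain ⟨x₀, hx₀, hθ⟩ : ∃ x₀ : ℝ, 0 ≤ x₀ ∧ z * Real.exp (-(ρ * x₀)) < 1 := by
    have : Tendsto (fun x => z * Real.exp (-(ρ * x))) atTop (𝓝 (z * 0)) :=
      (Real.tendsto_exp_neg_atTop_nhds_zero.comp (tendsto_id.const_mul_atTop hρ.1)).const_mul z
    rw [mul_zero] at this
    exact ((eventually_ge_atTop 0).and (this.eventually (gt_mem_nhds one_pos))).exists
  rw [halfHankel_shift hx₀ (differentiableOn_mittagLefflerKernel hρ' hz)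
    (mittagLefflerKernel_ofReal_im ρ z) (integrableOn_mittagLefflerKernel hρ' hz le_rfl)]
  rw [← (hasSum_halfHankel_mittagLefflerKernel hρ.1 hz hθ hx₀).tsum_eq, mittagLeffler,
    ← tsum_mul_left]
  congr 1 with k
  rw [halfHankel_hankelKernel (by have := hρ.1; nlinarith [mul_nonneg hρ.1.le k.cast_nonneg]) hx₀]
  ring

/-! ### Lipschitz estimate of the remainder in the order -/

/-- The quantity `q = lam e ^ (ρ (ℓ - w))` occurring in the contour integral for
`E_ρ(-lam t ^ ρ)` with `ℓ = log t`. -/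
def contourRatio (lam ℓ : ℝ) (w : ℂ) (ρ : ℝ) : ℂ :=
  ((lam * Real.exp (ℓ * ρ) : ℝ) : ℂ) * Complex.exp (-(ρ * w))

/-- The kernel `1 / q - 1 / (1 + q)` of the remainder in the asymptotics of `E_ρ(-lam t ^ ρ)`. -/
def remainderKernel (lam ℓ ρ : ℝ) (w : ℂ) : ℂ :=
  Complex.exp (Complex.exp w) * (contourRatio lam ℓ w ρ * (1 + contourRatio lam ℓ w ρ))⁻¹

lemma norm_contourRatio {lam : ℝ} (hlam : 0 ≤ lam) (ℓ x y ρ : ℝ) :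
    ‖contourRatio lam ℓ (x + y * Complex.I) ρ‖ = lam * Real.exp (ℓ * ρ) * Real.exp (-(ρ * x)) :=
  norm_ofReal_mul_exp_neg_mul (by positivity) ρ x y

lemma hasDerivAt_contourRatio (lam ℓ : ℝ) (w : ℂ) (ρ : ℝ) :
    HasDerivAt (contourRatio lam ℓ w) ((ℓ - w) * contourRatio lam ℓ w ρ) ρ := by
  unfold contourRatio
  have h1 : HasDerivAt (fun ρ : ℝ => ((lam * Real.exp (ℓ * ρ) : ℝ) : ℂ))
      ((lam * (Real.exp (ℓ * ρ) * ℓ) : ℝ) : ℂ) ρ := by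
    have := (((hasDerivAt_id ρ).const_mul ℓ).exp.const_mul lam).ofReal_comp
    simpa using this
  have h2 : HasDerivAt (fun ρ : ℝ => Complex.exp (-(ρ * w)))
      (Complex.exp (-(ρ * w)) * (-w)) ρ := by
    have := (((hasDerivAt_id (ρ : ℂ)).mul_const w).neg.cexp).comp_ofReal
    simpa using this
  refine (h1.mul h2).congr_deriv ?_
  push_cast
  ring

lemma contourRatio_ne_zero {lam : ℝ} (hlam : 0 < lam) (ℓ : ℝ) (w : ℂ) (ρ : ℝ) :
    contourRatio lam ℓ w ρ ≠ 0 :=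
  mul_ne_zero (Complex.ofReal_ne_zero.2 (by positivity)) (Complex.exp_ne_zero _)

/-- With `q' = (ℓ - w) q` and `1 + 2q = (1 + q) + q` the derivative splits into two terms, each of
size `‖q‖⁻²` once `‖q‖ ≤ c ‖1 + q‖`; this is the source of the factor `c + c ^ 2` below. -/
lemma hasDerivAt_inv_contourRatio {lam ℓ : ℝ} {w : ℂ} {ρ : ℝ} (h0 : contourRatio lam ℓ w ρ ≠ 0)
    (h1 : 1 + contourRatio lam ℓ w ρ ≠ 0) :
    HasDerivAt (fun ρ => (contourRatio lam ℓ w ρ * (1 + contourRatio lam ℓ w ρ))⁻¹)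
      (-((ℓ - w) * (((contourRatio lam ℓ w ρ) * (1 + contourRatio lam ℓ w ρ))⁻¹ +
        ((1 + contourRatio lam ℓ w ρ) ^ 2)⁻¹))) ρ := by
  have hq := hasDerivAt_contourRatio lam ℓ w ρ
  refine ((hq.mul (hq.const_add 1)).inv (mul_ne_zero h0 h1)).congr_deriv ?_
  simp only [Pi.mul_apply]
  field_simp

/-- Lipschitz bound in the order for the kernel of the remainder. -/
lemma norm_inv_contourRatio_sub_le {lam ℓ : ℝ} (hlam : 0 < lam) (hℓ : 0 ≤ ℓ) {x y : ℝ}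
    (hx : 0 ≤ x) {ρ σ c : ℝ} (hρσ : ρ ≤ σ) (hσ : σ ≤ 1) (hc : 0 ≤ c)
    (h1 : ∀ τ ∈ Icc ρ σ, 1 + contourRatio lam ℓ (x + y * Complex.I) τ ≠ 0)
    (hb : ∀ τ ∈ Icc ρ σ, ‖contourRatio lam ℓ (x + y * Complex.I) τ‖ ≤
      c * ‖1 + contourRatio lam ℓ (x + y * Complex.I) τ‖) :
    ‖(contourRatio lam ℓ (x + y * Complex.I) ρ *
        (1 + contourRatio lam ℓ (x + y * Complex.I) ρ))⁻¹ -
      (contourRatio lam ℓ (x + y * Complex.I) σ *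
        (1 + contourRatio lam ℓ (x + y * Complex.I) σ))⁻¹‖ ≤
      (‖(ℓ : ℂ) - (x + y * Complex.I)‖ * ((c + c ^ 2) * (Real.exp (2 * x) /
        (lam * Real.exp (ℓ * ρ)) ^ 2))) * (σ - ρ) := by
  set w : ℂ := x + y * Complex.I with hw
  have key := (convex_Icc ρ σ).norm_image_sub_le_of_norm_hasDerivWithin_le
    (f := fun ρ => (contourRatio lam ℓ w ρ * (1 + contourRatio lam ℓ w ρ))⁻¹)
    (C := ‖(ℓ : ℂ) - w‖ * ((c + c ^ 2) * (Real.exp (2 * x) / (lam * Real.exp (ℓ * ρ)) ^ 2)))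
    (fun τ hτ => (hasDerivAt_inv_contourRatio (contourRatio_ne_zero hlam ℓ w τ)
      (h1 τ hτ)).hasDerivWithinAt)
    (fun τ hτ => ?_) (right_mem_Icc.2 hρσ) (left_mem_Icc.2 hρσ)
  · refine key.trans (le_of_eq ?_)
    rw [Real.norm_eq_abs, abs_sub_comm, abs_of_nonneg (sub_nonneg.2 hρσ)]
  · have hq0 : 0 < ‖contourRatio lam ℓ w τ‖ := norm_pos_iff.2 (contourRatio_ne_zero hlam ℓ w τ)
    have hq1 : 0 < ‖1 + contourRatio lam ℓ w τ‖ := norm_pos_iff.2 (h1 τ hτ)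
    have hinv : ‖1 + contourRatio lam ℓ w τ‖⁻¹ ≤ c * ‖contourRatio lam ℓ w τ‖⁻¹ := by
      rw [← div_eq_mul_inv, le_div_iff₀ hq0, inv_mul_le_iff₀ hq1, mul_comm]
      exact hb τ hτ
    have hqinv : ‖contourRatio lam ℓ w τ‖⁻¹ ^ 2 ≤
        Real.exp (2 * x) / (lam * Real.exp (ℓ * ρ)) ^ 2 := by
      rw [hw, norm_contourRatio hlam.le, inv_pow, mul_pow, mul_inv, ← Real.exp_nat_mul,
        ← Real.exp_neg, div_eq_mul_inv, mul_comm]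
      have hτ0 := hτ.1
      have hτ1 := hτ.2
      gcongr
      push_cast
      nlinarith
    rw [norm_neg, norm_mul]
    refine mul_le_mul_of_nonneg_left ?_ (norm_nonneg _)
    refine (norm_add_le _ _).trans ?_
    rw [norm_inv, norm_inv, norm_mul, norm_pow, mul_inv, ← inv_pow]
    have hnn : 0 ≤ ‖1 + contourRatio lam ℓ w τ‖⁻¹ := by positivity
    calc _ ≤ ‖contourRatio lam ℓ w τ‖⁻¹ * (c * ‖contourRatio lam ℓ w τ‖⁻¹) +
          (c * ‖contourRatio lam ℓ w τ‖⁻¹) ^ 2 := by gcongr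
      _ = (c + c ^ 2) * ‖contourRatio lam ℓ w τ‖⁻¹ ^ 2 := by ring
      _ ≤ _ := by gcongr

lemma norm_sub_le_of_strip {ℓ x y : ℝ} (hℓ : 9.3 ≤ ℓ) (hx : 0 ≤ x) (h0 : 0 ≤ y)
    (h1 : y ≤ rayAngle) : ‖(ℓ : ℂ) - (x + y * Complex.I)‖ ≤ 1.04 * ℓ + x := by
  have hsplit : (ℓ : ℂ) - (x + y * Complex.I) = ((ℓ : ℂ) - y * Complex.I) - x := by ring
  rw [hsplit]
  refine (norm_sub_le _ _).trans (add_le_add ?_ ?_)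
  -- The factor `1.04` absorbs the imaginary part: `y ^ 2 ≤ 2.3565 ^ 2 < (1.04 ^ 2 - 1) * 9.3 ^ 2`.
  · refine le_of_sq_le_sq ?_ (by linarith)
    rw [← Complex.normSq_eq_norm_sq, Complex.normSq_apply]
    simp
    have hy : y ≤ 2.3565 := h1.trans (by unfold rayAngle; linarith [Real.pi_lt_d4])
    nlinarith
  · rw [Complex.norm_real, Real.norm_of_nonneg hx]

lemma norm_contourRatio_le_sqrt_two_mul {lam ℓ x y τ : ℝ} (hlam : 0 < lam)
    (hτ : τ ∈ Icc (0 : ℝ) 1) (h0 : 0 ≤ y) (h1 : y ≤ rayAngle) :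
    ‖contourRatio lam ℓ (x + y * Complex.I) τ‖ ≤
      √2 * ‖1 + contourRatio lam ℓ (x + y * Complex.I) τ‖ := by
  have h := (normSq_one_add_ge (x := x) (z := lam * Real.exp (ℓ * τ)) hτ (by positivity) h0 h1).2
  refine le_of_sq_le_sq ?_ (by positivity)
  rw [mul_pow, Real.sq_sqrt (by norm_num)]
  unfold contourRatio
  linarith

lemma norm_contourRatio_le_of_large {q : ℂ} (hq : 80 ≤ ‖q‖) : ‖q‖ ≤ 80 / 79 * ‖1 + q‖ := by
  have : ‖q‖ - 1 ≤ ‖1 + q‖ := by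
    have := norm_sub_le (1 + q) 1
    simp at this
    linarith
  linarith

lemma exp_neg_seven_tenths_le : Real.exp (-(7 / 10)) ≤ 0.5142 := by
  have h := Real.quadratic_le_exp_of_nonneg (x := 7 / 10) (by norm_num)
  rw [Real.exp_neg]
  refine inv_le_of_inv_le₀ (by norm_num) (le_trans ?_ h)
  norm_num

lemma ray_majorant {A : ℝ} (hA : 0 ≤ A) :
    IntegrableOn (fun x => Real.exp (-(7 / 10 * Real.exp x)) *
      (A * Real.exp x ^ 2 + Real.exp x ^ 3)) (Ioi 0) ∧
    ∫ x in Ioi 0, Real.exp (-(7 / 10 * Real.exp x)) * (A * Real.exp x ^ 2 + Real.exp x ^ 3) ≤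
      1.785 * A + 5.84 := by
  -- In `u = e ^ x` the integrand is `exp (-7u / 10) (A u + u ^ 2) du`. Its antiderivative is a
  -- quadratic in `u` times the exponential, and `b` comes from matching coefficients.
  set b : ℝ := (A + 20 / 7) * (10 / 7) with hb
  set F : ℝ → ℝ := fun x => -((b * (10 / 7) + b * Real.exp x + 10 / 7 * Real.exp x ^ 2) *
    Real.exp (-(7 / 10 * Real.exp x))) with hF
  have hd : ∀ x ∈ Ici (0 : ℝ), HasDerivAt F (Real.exp (-(7 / 10 * Real.exp x)) *
      (A * Real.exp x ^ 2 + Real.exp x ^ 3)) x := by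
    intro x _
    have he := Real.hasDerivAt_exp x
    have h1 := (((he.const_mul b).const_add (b * (10 / 7))).add ((he.pow 2).const_mul (10 / 7))).mul
      ((he.const_mul (7 / 10)).neg.exp)
    refine h1.neg.congr_deriv ?_
    simp only [Pi.neg_apply, Pi.add_apply, Pi.pow_apply]
    rw [hb]
    push_cast
    ring
  have hlim : Tendsto F atTop (𝓝 0) := by
    have h (n : ℕ) : Tendsto (fun x => Real.exp x ^ n * Real.exp (-(7 / 10 * Real.exp x))) atTop
        (𝓝 0) := by
      have h1 : Tendsto (fun u : ℝ => u ^ (n : ℝ) * Real.exp (-(7 / 10) * u)) atTop (𝓝 0) :=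
        tendsto_rpow_mul_exp_neg_mul_atTop_nhds_zero n _ (by norm_num)
      refine (h1.comp Real.tendsto_exp_atTop).congr fun x => ?_
      simp only [Function.comp, Real.rpow_natCast]
      ring_nf
    have := ((((h 0).const_mul (b * (10 / 7))).add ((h 1).const_mul b)).add
      ((h 2).const_mul (10 / 7))).neg
    simp only [mul_zero, add_zero, neg_zero] at this
    refine this.congr fun x => ?_
    simp only [hF]
    ring
  have hint := integrableOn_Ioi_deriv_of_nonneg' hd (fun x _ => by positivity) hlim
  refine ⟨hint, ?_⟩
  rw [integral_Ioi_of_hasDerivAt_of_tendsto' hd hint hlim]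
  simp only [hF, Real.exp_zero, mul_one, one_pow]
  have := exp_neg_seven_tenths_le
  have hb0 : 0 ≤ b := by positivity
  have := mul_le_mul_of_nonneg_left exp_neg_seven_tenths_le
    (show 0 ≤ b * (10 / 7) + b + 10 / 7 by positivity)
  linarith

lemma abs_halfHankel_le (x₀ : ℝ) (g : ℂ → ℂ) :
    |halfHankel x₀ g| ≤ ‖∫ x : ℝ in Ioi x₀, g (x + rayAngle * Complex.I)‖ +
      ‖∫ y : ℝ in (0 : ℝ)..rayAngle, g (x₀ + y * Complex.I)‖ := by
  refine (Complex.abs_im_le_norm _).trans ((norm_add_le _ _).trans ?_)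
  rw [norm_mul, Complex.norm_I, one_mul]

/-- Lipschitz bound in the order for the remainder. -/
lemma abs_halfHankel_remainderKernel_sub_le {lam ℓ ρ σ : ℝ} (hlam : 0 < lam) (hℓ : 9.3 ≤ ℓ)
    (hρ : 0 ≤ ρ) (hρσ : ρ ≤ σ) (hσ : σ ≤ 1) (hz : 9.2 * ℓ ≤ lam * Real.exp (ℓ * ρ)) :
    |halfHankel 0 (fun w => remainderKernel lam ℓ ρ w - remainderKernel lam ℓ σ w)| ≤
      22 * ℓ / (lam * Real.exp (ℓ * ρ)) ^ 2 * (σ - ρ) := by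
  set Z := (lam * Real.exp (ℓ * ρ)) ^ 2 with hZ
  have hZ0 : 0 < Z := by positivity
  have hs0 : 0 ≤ σ - ρ := sub_nonneg.2 hρσ
  have hsub : ∀ τ ∈ Icc ρ σ, τ ∈ Icc (0 : ℝ) 1 := fun τ hτ => ⟨hρ.trans hτ.1, hτ.2.trans hσ⟩
  have hne : ∀ x y : ℝ, 0 ≤ y → y ≤ rayAngle → ∀ τ ∈ Icc ρ σ,
      1 + contourRatio lam ℓ (x + y * Complex.I) τ ≠ 0 := fun x y h0 h1 τ hτ =>
    one_add_ne_zero (hsub τ hτ) (by positivity) h0 h1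
  have hray : ‖∫ x : ℝ in Ioi 0, (remainderKernel lam ℓ ρ (x + rayAngle * Complex.I) -
      remainderKernel lam ℓ σ (x + rayAngle * Complex.I))‖ ≤ 7.9 * ℓ / Z * (σ - ρ) := by
    -- The majorant is used with `A = 1.04 ℓ - 1`, since `x ≤ e ^ x - 1`. The constant `3.4143`
    -- bounds `c + c ^ 2` for `c = √2`.
    have hA : 0 ≤ 1.04 * ℓ - 1 := by linarith
    obtain ⟨hint, hle⟩ := ray_majorant hA
    have h2 : √2 ≤ 1.4143 := Real.sqrt_le_iff.2 ⟨by norm_num, by norm_num⟩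
    calc _ ≤ ∫ x in Ioi (0 : ℝ), 3.4143 / Z * (σ - ρ) *
          (Real.exp (-(7 / 10 * Real.exp x)) *
            ((1.04 * ℓ - 1) * Real.exp x ^ 2 + Real.exp x ^ 3)) := by
          refine norm_integral_le_of_norm_le (hint.const_mul _)
            ((ae_restrict_iff' measurableSet_Ioi).2 (Eventually.of_forall fun x hx => ?_))
          have hx : 0 ≤ x := (mem_Ioi.1 hx).le
          unfold remainderKernel
          rw [← mul_sub, norm_mul]
          have h3 := norm_inv_contourRatio_sub_le hlam (by linarith) hx hρσ hσ
            (Real.sqrt_nonneg 2) (hne x rayAngle rayAngle_pos.le le_rfl) (fun τ hτ =>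
              norm_contourRatio_le_sqrt_two_mul hlam (hsub τ hτ) rayAngle_pos.le le_rfl)
          have h4 := norm_sub_le_of_strip hℓ hx rayAngle_pos.le le_rfl
          have h5 : 1.04 * ℓ + x ≤ (1.04 * ℓ - 1) + Real.exp x := by
            linarith [Real.add_one_le_exp x]
          have h6 : √2 + √2 ^ 2 ≤ 3.4143 := by
            rw [Real.sq_sqrt (by norm_num)]; linarith
          calc _ ≤ Real.exp (-(7 / 10 * Real.exp x)) *
                ((((1.04 * ℓ - 1) + Real.exp x) * (3.4143 * (Real.exp (2 * x) / Z))) *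
                  (σ - ρ)) := by
                refine mul_le_mul (norm_exp_exp_ray_le le_rfl rayAngle_lt_pi.le)
                  (h3.trans ?_) (norm_nonneg _) (Real.exp_pos _).le
                gcongr
                exact h4.trans h5
            _ = _ := by
                rw [show Real.exp (2 * x) = Real.exp x ^ 2 by
                  rw [← Real.exp_nat_mul]; push_cast; rfl]
                ring
      _ ≤ 3.4143 / Z * (σ - ρ) * (1.785 * (1.04 * ℓ - 1) + 5.84) := by
          rw [integral_const_mul]
          gcongr
      _ = 3.4143 * (1.785 * (1.04 * ℓ - 1) + 5.84) / Z * (σ - ρ) := by ring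
      _ ≤ _ := by
          have : 3.4143 * (1.785 * (1.04 * ℓ - 1) + 5.84) ≤ 7.9 * ℓ := by linarith
          gcongr
  have hseg : ‖∫ y : ℝ in (0 : ℝ)..rayAngle,
      (remainderKernel lam ℓ ρ ((0 : ℝ) + y * Complex.I) -
        remainderKernel lam ℓ σ ((0 : ℝ) + y * Complex.I))‖ ≤ 14 * ℓ / Z * (σ - ρ) := by
    have hbound : ∀ y ∈ uIoc (0 : ℝ) rayAngle,
        ‖remainderKernel lam ℓ ρ ((0 : ℝ) + y * Complex.I) -
          remainderKernel lam ℓ σ ((0 : ℝ) + y * Complex.I)‖ ≤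
        2.7183 * (1.04 * ℓ * (2.039 / Z) * (σ - ρ)) := by
      intro y hy
      rw [uIoc_of_le rayAngle_pos.le] at hy
      unfold remainderKernel
      rw [← mul_sub, norm_mul]
      -- On the segment `‖q‖ ≥ 9.2 * 9.3 > 80`, so `c = 80 / 79` is allowed and `c + c ^ 2 < 2.039`.
      -- The cruder `c = √2` would make the total too large for the final comparison.
      have h3 := norm_inv_contourRatio_sub_le (y := y) (c := 80 / 79) hlam (by linarith) le_rfl
        hρσ hσ (by norm_num) (hne 0 y hy.1.le hy.2) (fun τ hτ => by
          refine norm_contourRatio_le_of_large ?_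
          rw [norm_contourRatio hlam.le, mul_zero, neg_zero, Real.exp_zero, mul_one]
          have hm : lam * Real.exp (ℓ * ρ) ≤ lam * Real.exp (ℓ * τ) := by
            have := hτ.1
            gcongr
          linarith)
      have h4 := norm_sub_le_of_strip hℓ le_rfl hy.1.le hy.2
      have h5 : ‖Complex.exp (Complex.exp ((0 : ℝ) + y * Complex.I))‖ ≤ 2.7183 := by
        refine (norm_exp_exp_le 0 y).trans ?_
        rw [Real.exp_zero]
        linarith [Real.exp_one_lt_d9]
      refine mul_le_mul h5 (h3.trans ?_) (norm_nonneg _) (by norm_num)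
      rw [mul_zero, Real.exp_zero, add_zero] at *
      rw [← hZ, mul_one_div]
      gcongr
      norm_num
    refine (intervalIntegral.norm_integral_le_of_norm_le_const hbound).trans ?_
    rw [sub_zero, abs_of_pos rayAngle_pos]
    have hβ : rayAngle ≤ 2.3565 := by unfold rayAngle; linarith [Real.pi_lt_d4]
    calc _ ≤ 2.7183 * (1.04 * ℓ * (2.039 / Z) * (σ - ρ)) * 2.3565 := by gcongr
      _ = (2.7183 * 1.04 * 2.039 * 2.3565) * ℓ / Z * (σ - ρ) := by ring
      _ ≤ _ := by gcongr; norm_num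
  refine (abs_halfHankel_le _ _).trans ((add_le_add hray hseg).trans ?_)
  rw [← add_mul, ← add_div]
  gcongr
  linarith

/-! ### Splitting off the leading term -/

/-- The integrals over the two parts of the half Hankel contour with `x₀ = 0` converge. -/
def HankelIntegrable (g : ℂ → ℂ) : Prop :=
  IntegrableOn (fun x : ℝ => g (x + rayAngle * Complex.I)) (Ioi 0) ∧
    IntervalIntegrable (fun y : ℝ => g ((0 : ℝ) + y * Complex.I)) volume 0 rayAngle

lemma HankelIntegrable.sub {f g : ℂ → ℂ} (hf : HankelIntegrable f) (hg : HankelIntegrable g) :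
    HankelIntegrable fun w => f w - g w :=
  ⟨hf.1.sub hg.1, hf.2.sub hg.2⟩

lemma HankelIntegrable.const_mul {f : ℂ → ℂ} (hf : HankelIntegrable f) (c : ℂ) :
    HankelIntegrable fun w => c * f w :=
  ⟨hf.1.const_mul c, hf.2.const_mul c⟩

lemma halfHankel_sub {f g : ℂ → ℂ} (hf : HankelIntegrable f) (hg : HankelIntegrable g) :
    halfHankel 0 (fun w => f w - g w) = halfHankel 0 f - halfHankel 0 g := by
  unfold halfHankel
  rw [integral_sub hf.1 hg.1, intervalIntegral.integral_sub hf.2 hg.2]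
  simp only [Complex.add_im, Complex.sub_im, Complex.mul_im, Complex.I_re, Complex.I_im,
    Complex.sub_re]
  ring

lemma halfHankel_congr {f g : ℂ → ℂ} (h : ∀ w ∈ hankelStrip, f w = g w) :
    halfHankel 0 f = halfHankel 0 g := by
  unfold halfHankel
  congr 3
  · ext x
    exact h _ (by simp [hankelStrip, rayAngle_pos.le])
  · refine intervalIntegral.integral_congr fun y hy => ?_
    rw [uIcc_of_le rayAngle_pos.le] at hy
    exact h _ (by simpa [hankelStrip] using hy)

lemma hankelIntegrable_hankelKernel {a : ℝ} (ha : -1 ≤ a) :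
    HankelIntegrable (hankelKernel a) :=
  ⟨integrableOn_hankelKernel ha 0 le_rfl rayAngle_lt_pi.le,
    ((differentiable_hankelKernel a).continuous.comp (by fun_prop)).intervalIntegrable _ _⟩

lemma hankelIntegrable_mittagLefflerKernel {ρ z : ℝ} (hρ : ρ ∈ Icc (0 : ℝ) 1) (hz : 0 ≤ z) :
    HankelIntegrable (mittagLefflerKernel ρ z) := by
  refine ⟨integrableOn_mittagLefflerKernel hρ hz le_rfl, ContinuousOn.intervalIntegrable ?_⟩
  refine (differentiableOn_mittagLefflerKernel hρ hz).continuousOn.comp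
    (Continuous.continuousOn (by fun_prop)) fun y hy => ?_
  rw [uIcc_of_le rayAngle_pos.le] at hy
  simpa [hankelStrip] using hy

lemma remainderKernel_eq {lam ℓ ρ : ℝ} (hlam : 0 < lam) (hρ : ρ ∈ Icc (0 : ℝ) 1) {w : ℂ}
    (hw : w ∈ hankelStrip) :
    remainderKernel lam ℓ ρ w =
      (((lam * Real.exp (ℓ * ρ))⁻¹ : ℝ) : ℂ) * hankelKernel (-ρ) w -
        mittagLefflerKernel ρ (lam * Real.exp (ℓ * ρ)) w := by
  have hz : (((lam * Real.exp (ℓ * ρ)) : ℝ) : ℂ) ≠ 0 := Complex.ofReal_ne_zero.2 (by positivity)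
  have h1 := one_add_ne_zero (x := w.re) (z := lam * Real.exp (ℓ * ρ)) hρ (by positivity) hw.1 hw.2
  rw [Complex.re_add_im] at h1
  unfold remainderKernel contourRatio hankelKernel mittagLefflerKernel
  have h2 : Complex.exp (-(((-ρ : ℝ) : ℂ) * w)) = (Complex.exp (-(ρ * w)))⁻¹ := by
    rw [← Complex.exp_neg]; congr 1; push_cast; ring
  have h3 := Complex.exp_ne_zero (-(ρ * w))
  rw [h2, Complex.ofReal_inv]
  field_simp
  ring

/-- The leading term `1 / (lam t ^ ρ Γ(1 - ρ))` in the asymptotics of `E_ρ(-lam t ^ ρ)`. -/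
def leadingTerm (lam ℓ ρ : ℝ) : ℝ :=
  (1 - ρ) * (Real.exp (-(ℓ * ρ)) / Real.Gamma (2 - ρ)) / lam

lemma eFun_exp (lam ℓ ρ : ℝ) :
    eFun lam (Real.exp ℓ) ρ = mittagLeffler ρ (-(lam * Real.exp (ℓ * ρ))) := by
  rw [eFun, ← Real.exp_mul]

/-- Hankel's formula at `a = -ρ` produces `1 / Γ(1 - ρ)`; in the form `(1 - ρ) / Γ(2 - ρ)` it has no
singular factor at `ρ = 1`. -/
lemma inv_mul_halfHankel_hankelKernel {lam ℓ ρ : ℝ} (hρ : ρ ≤ 1) :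
    (lam * Real.exp (ℓ * ρ))⁻¹ * halfHankel 0 (hankelKernel (-ρ)) =
      Real.pi * leadingTerm lam ℓ ρ := by
  rw [halfHankel_hankelKernel (by linarith) le_rfl, leadingTerm, Real.exp_neg]
  rcases hρ.eq_or_lt with rfl | h
  · simp
  · have h1 : Real.Gamma (2 - ρ) = (1 - ρ) * Real.Gamma (1 - ρ) := by
      rw [← Real.Gamma_add_one (by linarith)]
      congr 1
      ring
    have h2 : Real.Gamma (1 - ρ) ≠ 0 := (Real.Gamma_pos_of_pos (by linarith)).ne'
    have h3 : 1 - ρ ≠ 0 := by linarith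
    rw [h1, neg_add_eq_sub]
    field_simp

lemma pi_mul_eFun_sub {lam ℓ ρ σ : ℝ} (hlam : 0 < lam) (hρ : ρ ∈ Ioc (0 : ℝ) 1)
    (hσ : σ ∈ Ioc (0 : ℝ) 1) :
    Real.pi * (eFun lam (Real.exp ℓ) ρ - eFun lam (Real.exp ℓ) σ) =
      Real.pi * (leadingTerm lam ℓ ρ - leadingTerm lam ℓ σ) -
        halfHankel 0 (fun w => remainderKernel lam ℓ ρ w - remainderKernel lam ℓ σ w) := by
  have hρ' : ρ ∈ Icc (0 : ℝ) 1 := ⟨hρ.1.le, hρ.2⟩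
  have hσ' : σ ∈ Icc (0 : ℝ) 1 := ⟨hσ.1.le, hσ.2⟩
  have hA (τ : ℝ) (hτ : τ ∈ Icc (0 : ℝ) 1) :=
    (hankelIntegrable_hankelKernel (a := -τ) (by linarith [hτ.2])).const_mul
      (((lam * Real.exp (ℓ * τ))⁻¹ : ℝ) : ℂ)
  have hB (τ : ℝ) (hτ : τ ∈ Icc (0 : ℝ) 1) :=
    hankelIntegrable_mittagLefflerKernel (z := lam * Real.exp (ℓ * τ)) hτ (by positivity)
  rw [halfHankel_congr (fun w hw => by
    rw [remainderKernel_eq hlam hρ' hw, remainderKernel_eq hlam hσ' hw]),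
    halfHankel_sub ((hA ρ hρ').sub (hB ρ hρ')) ((hA σ hσ').sub (hB σ hσ')),
    halfHankel_sub (hA ρ hρ') (hB ρ hρ'), halfHankel_sub (hA σ hσ') (hB σ hσ'),
    halfHankel_ofReal_mul, halfHankel_ofReal_mul, inv_mul_halfHankel_hankelKernel hρ.2,
    inv_mul_halfHankel_hankelKernel hσ.2, halfHankel_mittagLefflerKernel hρ (by positivity),
    halfHankel_mittagLefflerKernel hσ (by positivity), eFun_exp, eFun_exp]
  ring

/-! ### Strict decrease in the order -/

lemma Gamma_le_one_of_mem {s : ℝ} (h1 : 1 ≤ s) (h2 : s ≤ 2) : Real.Gamma s ≤ 1 := by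
  have := Real.convexOn_Gamma.le_max_of_mem_Icc (x := 1) (y := 2) (z := s) (by simp) (by simp)
    ⟨h1, h2⟩
  simpa [Real.Gamma_one, Real.Gamma_two] using this

/-- By convexity the slope of `log Γ` on `[a, b]` is at most its slope on `[b, b + 1]`, which is
`log b ≤ b - 1 ≤ 1 ≤ ℓ`. Consequently `exp (-ℓ ρ) / Γ(2 - ρ)` is nonincreasing in `ρ`. -/
lemma Gamma_le_mul_exp {a b ℓ : ℝ} (ha : 0 < a) (hab : a ≤ b) (hb : b ≤ 2) (hℓ : 1 ≤ ℓ) :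
    Real.Gamma b ≤ Real.Gamma a * Real.exp (ℓ * (b - a)) := by
  rcases hab.eq_or_lt with rfl | hab
  · simp
  have hb0 : 0 < b := ha.trans hab
  have hga := Real.Gamma_pos_of_pos ha
  have hgb := Real.Gamma_pos_of_pos hb0
  have hs := Real.convexOn_log_Gamma.slope_mono_adjacent (x := a) (y := b) (z := b + 1) ha
    (by simp; linarith) hab (by linarith)
  simp only [Function.comp] at hs
  rw [Real.Gamma_add_one hb0.ne', Real.log_mul hb0.ne' hgb.ne', add_sub_cancel_right,
    add_sub_cancel_left, div_one, div_le_iff₀ (by linarith)] at hs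
  have hlog := Real.log_le_sub_one_of_pos hb0
  rw [← Real.log_le_log_iff hgb (by positivity), Real.log_mul hga.ne' (Real.exp_pos _).ne',
    Real.log_exp]
  nlinarith

lemma le_leadingTerm_sub {lam ℓ ρ σ : ℝ} (hlam : 0 < lam) (hℓ : 1 ≤ ℓ) (hρ : 0 ≤ ρ)
    (hρσ : ρ ≤ σ) (hσ : σ ≤ 1) :
    (σ - ρ) / (lam * Real.exp (ℓ * σ)) ≤ leadingTerm lam ℓ ρ - leadingTerm lam ℓ σ := by
  have hgρ : 0 < Real.Gamma (2 - ρ) := Real.Gamma_pos_of_pos (by linarith)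
  have hgσ : 0 < Real.Gamma (2 - σ) := Real.Gamma_pos_of_pos (by linarith)
  have h1 : Real.exp (-(ℓ * σ)) / Real.Gamma (2 - σ) ≤
      Real.exp (-(ℓ * ρ)) / Real.Gamma (2 - ρ) := by
    rw [div_le_div_iff₀ hgσ hgρ]
    have h := Gamma_le_mul_exp (a := 2 - σ) (b := 2 - ρ) (by linarith) (by linarith)
      (by linarith) hℓ
    calc _ ≤ Real.exp (-(ℓ * σ)) *
          (Real.Gamma (2 - σ) * Real.exp (ℓ * (2 - ρ - (2 - σ)))) := by gcongr
      _ = (Real.exp (-(ℓ * σ)) * Real.exp (ℓ * (2 - ρ - (2 - σ)))) * Real.Gamma (2 - σ) := by ring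
      _ = _ := by rw [← Real.exp_add]; ring_nf
  have h2 : Real.exp (-(ℓ * σ)) ≤ Real.exp (-(ℓ * σ)) / Real.Gamma (2 - σ) :=
    le_div_self (Real.exp_pos _).le hgσ (Gamma_le_one_of_mem (by linarith) (by linarith))
  unfold leadingTerm
  rw [← sub_div, div_mul_eq_div_div_swap, div_eq_mul_inv (σ - ρ), ← Real.exp_neg]
  gcongr
  have h3 := mul_le_mul_of_nonneg_left h1 (show 0 ≤ 1 - ρ by linarith)
  have h4 := mul_le_mul_of_nonneg_left h2 (show 0 ≤ σ - ρ by linarith)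
  linarith

/-- Closeness of the orders keeps `exp (-ℓ (σ - ρ)) ≥ 0.9`. In units of `(σ - ρ) / z` the leading
term then contributes at least `3.14 * 0.9 = 2.826`, the remainder at most `22 / 9.2 < 2.4`. -/
lemma eFun_lt_of_close {lam ℓ ρ σ : ℝ} (hlam : 0 < lam) (hℓ : 9.3 ≤ ℓ) (hρ : 0 < ρ)
    (hρσ : ρ < σ) (hσ : σ ≤ 1) (hz : 9.2 * ℓ ≤ lam * Real.exp (ℓ * ρ))
    (hclose : ℓ * (σ - ρ) ≤ 1 / 10) :
    eFun lam (Real.exp ℓ) σ < eFun lam (Real.exp ℓ) ρ := by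
  have hR := abs_halfHankel_remainderKernel_sub_le hlam hℓ hρ.le hρσ.le hσ hz
  have hM := le_leadingTerm_sub hlam (by linarith) hρ.le hρσ.le hσ (ℓ := ℓ)
  have heq := pi_mul_eFun_sub (ℓ := ℓ) hlam ⟨hρ, hρσ.le.trans hσ⟩ ⟨hρ.trans hρσ, hσ⟩
  set z := lam * Real.exp (ℓ * ρ) with hz'
  have hz0 : 0 < z := by positivity
  have hs : 0 < σ - ρ := sub_pos.2 hρσ
  have hzσ : (lam * Real.exp (ℓ * σ))⁻¹ = z⁻¹ * Real.exp (-(ℓ * (σ - ρ))) := by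
    rw [hz', Real.exp_neg, ← mul_inv, mul_assoc, ← Real.exp_add]
    congr 3
    ring
  have h1 : 0.9 * z⁻¹ ≤ (lam * Real.exp (ℓ * σ))⁻¹ := by
    rw [hzσ, mul_comm]
    gcongr
    have := Real.add_one_le_exp (-(ℓ * (σ - ρ)))
    linarith
  have h2 : 22 * ℓ / z ^ 2 ≤ 2.4 * z⁻¹ := by
    rw [div_le_iff₀ (by positivity)]
    field_simp
    linarith
  have hpi := Real.pi_gt_d2
  have hmain : 2.826 * z⁻¹ * (σ - ρ) ≤
      Real.pi * (leadingTerm lam ℓ ρ - leadingTerm lam ℓ σ) := by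
    calc 2.826 * z⁻¹ * (σ - ρ) = 3.14 * ((σ - ρ) * (0.9 * z⁻¹)) := by ring
      _ ≤ Real.pi * ((σ - ρ) * (lam * Real.exp (ℓ * σ))⁻¹) := by gcongr
      _ ≤ _ := by rw [← div_eq_mul_inv]; gcongr
  have hrem : |halfHankel 0 (fun w => remainderKernel lam ℓ ρ w - remainderKernel lam ℓ σ w)| ≤
      2.4 * z⁻¹ * (σ - ρ) := hR.trans (by gcongr)
  have hpos : 0 < z⁻¹ * (σ - ρ) := by positivity
  have := (abs_le.1 hrem).2
  have h3 : 0 < Real.pi * (eFun lam (Real.exp ℓ) ρ - eFun lam (Real.exp ℓ) σ) := by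
    rw [heq]; linarith
  exact sub_pos.1 (pos_of_mul_pos_right h3 Real.pi_pos.le)

/-- A function that decreases strictly between any two close points is strictly decreasing. -/
lemma strictAntiOn_of_close {f : ℝ → ℝ} {a b δ : ℝ} (hδ : 0 < δ)
    (h : ∀ x ∈ Icc a b, ∀ y ∈ Icc a b, x < y → y - x ≤ δ → f y < f x) :
    StrictAntiOn f (Icc a b) := by
  have key : ∀ n : ℕ, ∀ x ∈ Icc a b, ∀ y ∈ Icc a b, x < y → y - x ≤ n * δ → f y < f x := by
    intro n
    induction n with
    | zero =>
      intro x _ y _ hxy hn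
      simp at hn
      linarith
    | succ n ih =>
      intro x hx y hy hxy hn
      push_cast at hn
      rcases le_or_gt (y - x) δ with hc | hc
      · exact h x hx y hy hxy hc
      · have hm : x + δ ∈ Icc a b := ⟨by linarith [hx.1], by linarith [hy.2]⟩
        exact (ih _ hm y hy (by linarith) (by linarith)).trans
          (h x hx _ hm (by linarith) (by linarith))
  intro x hx y hy hxy
  obtain ⟨n, hn⟩ := exists_nat_ge ((y - x) / δ)
  exact key n x hx y hy hxy ((div_le_iff₀ hδ).1 hn)

theorem strictAntiOn_eFun {lam ℓ ρ₀ : ℝ} (hlam : 0 < lam) (hℓ : 9.3 ≤ ℓ) (hρ₀ : 0 < ρ₀)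
    (hz : 9.2 * ℓ ≤ lam * Real.exp (ℓ * ρ₀)) :
    StrictAntiOn (fun ρ => eFun lam (Real.exp ℓ) ρ) (Icc ρ₀ 1) := by
  have hℓ0 : 0 < ℓ := by linarith
  refine strictAntiOn_of_close (δ := 1 / 10 / ℓ) (by positivity) fun ρ hρ σ hσ hlt hc => ?_
  refine eFun_lt_of_close hlam hℓ (hρ₀.trans_le hρ.1) hlt hσ.2 (hz.trans ?_) ?_
  · have := hρ.1
    gcongr
  · rwa [le_div_iff₀ hℓ0, mul_comm] at hc

/-! ### Order one and the admissible threshold -/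

lemma mittagLeffler_one (z : ℝ) : mittagLeffler 1 z = Real.exp z := by
  rw [Real.exp_eq_exp_ℝ, NormedSpace.exp_eq_tsum_div, mittagLeffler]
  congr 1 with k
  rw [one_mul, Real.Gamma_nat_eq_factorial]

lemma eFun_one_pos (lam t : ℝ) : 0 < eFun lam t 1 := by
  rw [eFun, mittagLeffler_one]; exact Real.exp_pos _

lemma exists_admissibleExponent {lam₀ ρ₀ : ℝ} (hρ₀ : 0 < ρ₀) (hlam₀ : 0 < lam₀) :
    ∃ k : ℝ, AdmissibleExponent lam₀ ρ₀ k := by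
  -- The first summand makes `ρ₀ k ≥ 10 > 43 / 4.6`. The second makes `lam₀ (ρ₀ k) ^ 2 / 2 ≥ 9.2 k`,
  -- which gives the logarithmic condition through `exp u ≥ u ^ 2 / 2`.
  refine ⟨10 / ρ₀ + 18.4 / (lam₀ * ρ₀ ^ 2), ?_⟩
  set k := 10 / ρ₀ + 18.4 / (lam₀ * ρ₀ ^ 2) with hk
  have hk0 : 0 < k := by positivity
  have h1 : 10 ≤ ρ₀ * k := by
    rw [hk]
    have : 0 ≤ ρ₀ * (18.4 / (lam₀ * ρ₀ ^ 2)) := by positivity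
    have h : ρ₀ * (10 / ρ₀) = 10 := by field_simp
    linarith
  have h2 : 18.4 ≤ lam₀ * ρ₀ ^ 2 * k := by
    rw [hk]
    have : 0 ≤ lam₀ * ρ₀ ^ 2 * (10 / ρ₀) := by positivity
    have h : lam₀ * ρ₀ ^ 2 * (18.4 / (lam₀ * ρ₀ ^ 2)) = 18.4 := by field_simp
    linarith
  unfold AdmissibleExponent
  rw [one_div, inv_mul_le_iff₀ hρ₀, max_le_iff]
  refine ⟨by linarith, ?_⟩
  rw [Real.log_le_iff_le_exp (by positivity), div_le_iff₀ hlam₀]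
  have h3 := Real.quadratic_le_exp_of_nonneg (x := ρ₀ * k) (by positivity)
  have h4 : lam₀ * ((ρ₀ * k) ^ 2 / 2) ≤ lam₀ * Real.exp (ρ₀ * k) := by
    gcongr
    linarith
  nlinarith

lemma AdmissibleExponent.bounds {lam₀ ρ₀ k : ℝ} (hρ₀ : ρ₀ ∈ Ioo (0 : ℝ) 1) (hlam₀ : 0 < lam₀)
    (hk : AdmissibleExponent lam₀ ρ₀ k) {ℓ : ℝ} (hℓ : k ≤ ℓ) :
    9.3 ≤ ℓ ∧ 9.2 * ℓ ≤ lam₀ * Real.exp (ℓ * ρ₀) := by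
  unfold AdmissibleExponent at hk
  rw [one_div, inv_mul_le_iff₀ hρ₀.1, max_le_iff] at hk
  obtain ⟨h1, h2⟩ := hk
  have h1' : 9.3 ≤ ρ₀ * k := le_trans (by norm_num) h1
  have hk0 : 0 < k := pos_of_mul_pos_right (by linarith) hρ₀.1.le
  have hk1 : 9.3 ≤ k := h1'.trans (mul_le_of_le_one_left hk0.le hρ₀.2.le)
  refine ⟨hk1.trans hℓ, ?_⟩
  rw [Real.log_le_iff_le_exp (by positivity), div_le_iff₀ hlam₀] at h2
  have h3 := Real.add_one_le_exp (ρ₀ * (ℓ - k))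
  have hsplit : Real.exp (ℓ * ρ₀) = Real.exp (ρ₀ * k) * Real.exp (ρ₀ * (ℓ - k)) := by
    rw [← Real.exp_add]; ring_nf
  rw [hsplit]
  -- The inequality at `k` propagates to `ℓ ≥ k` because `ρ₀ k ≥ 1`: the exponential grows by at
  -- least `1 + ρ₀ (ℓ - k)`, hence by at least `ℓ / k`.
  calc 9.2 * ℓ ≤ (2 * 4.6 * k) * (ρ₀ * (ℓ - k) + 1) := by nlinarith
    _ ≤ (Real.exp (ρ₀ * k) * lam₀) * Real.exp (ρ₀ * (ℓ - k)) := by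
        have : 0 ≤ ρ₀ * (ℓ - k) := mul_nonneg hρ₀.1.le (sub_nonneg.2 hℓ)
        gcongr
    _ = _ := by ring

/-! ### Boundedness and Lipschitz continuity on the negative half-line -/

lemma exists_abs_halfHankel_le :
    ∃ K : ℝ, 0 ≤ K ∧ ∀ (h : ℂ → ℂ) (c : ℝ), 0 ≤ c →
      (∀ x y : ℝ, 0 ≤ x → 0 ≤ y → y ≤ rayAngle → ‖h (x + y * Complex.I)‖ ≤ c) →
      |halfHankel 0 (fun w => Complex.exp (Complex.exp w) * h w)| ≤ K * c := by
  refine ⟨(∫ x in Ioi 0, Real.exp (-(7 / 10 * Real.exp x)) * Real.exp x) +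
    Real.exp (Real.exp 0) * rayAngle, ?_, fun h c hc hb => ?_⟩
  · have := rayAngle_pos
    have : 0 ≤ ∫ x in Ioi 0, Real.exp (-(7 / 10 * Real.exp x)) * Real.exp x :=
      integral_nonneg fun x => by positivity
    positivity
  · refine (abs_halfHankel_le _ _).trans ?_
    rw [add_mul]
    refine add_le_add ?_ ?_
    · rw [← integral_mul_const]
      refine norm_integral_le_of_norm_le ((integrableOn_exp_neg_exp (by norm_num) 0).mul_const c)
        ((ae_restrict_iff' measurableSet_Ioi).2 (Eventually.of_forall fun x hx => ?_))
      have hx : 0 ≤ x := (mem_Ioi.1 hx).le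
      rw [norm_mul]
      refine mul_le_mul ?_ (hb x _ hx rayAngle_pos.le le_rfl) (norm_nonneg _) (by positivity)
      exact (norm_exp_exp_ray_le le_rfl rayAngle_lt_pi.le).trans
        (le_mul_of_one_le_right (Real.exp_pos _).le (Real.one_le_exp hx))
    · have : ∀ y ∈ uIoc (0 : ℝ) rayAngle,
          ‖Complex.exp (Complex.exp ((0 : ℝ) + y * Complex.I)) * h ((0 : ℝ) + y * Complex.I)‖ ≤
            Real.exp (Real.exp 0) * c := by
        intro y hy
        rw [uIoc_of_le rayAngle_pos.le] at hy
        rw [norm_mul]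
        exact mul_le_mul (norm_exp_exp_le 0 y) (hb 0 y le_rfl hy.1.le hy.2) (norm_nonneg _)
          (Real.exp_pos _).le
      refine (intervalIntegral.norm_integral_le_of_norm_le_const this).trans (le_of_eq ?_)
      rw [sub_zero, abs_of_pos rayAngle_pos]
      ring

/-- On the negative half-line the Mittag-Leffler function of order at most one is bounded. -/
theorem exists_abs_mittagLeffler_neg_le {ρ : ℝ} (hρ : ρ ∈ Ioc (0 : ℝ) 1) :
    ∃ C : ℝ, ∀ z : ℝ, 0 ≤ z → |mittagLeffler ρ (-z)| ≤ C := by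
  obtain ⟨K, _, hK⟩ := exists_abs_halfHankel_le
  refine ⟨K * √2 / Real.pi, fun z hz => ?_⟩
  have h := hK (fun w => (1 + z * Complex.exp (-(ρ * w)))⁻¹) (√2) (by positivity)
    (fun x y _ h0 h1 => norm_inv_one_add_le ⟨hρ.1.le, hρ.2⟩ hz h0 h1)
  have h2 := halfHankel_mittagLefflerKernel hρ hz
  unfold mittagLefflerKernel at h2
  simp only [div_eq_mul_inv] at h2
  rw [h2, abs_mul, abs_of_pos Real.pi_pos] at h
  rwa [le_div_iff₀ Real.pi_pos, mul_comm]

/-- On the negative half-line the Mittag-Leffler function of order at most one is Lipschitz. -/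
theorem exists_abs_mittagLeffler_neg_sub_le {ρ : ℝ} (hρ : ρ ∈ Ioc (0 : ℝ) 1) :
    ∃ C : ℝ, ∀ z₁ z₂ : ℝ, 0 ≤ z₁ → 0 ≤ z₂ →
      |mittagLeffler ρ (-z₁) - mittagLeffler ρ (-z₂)| ≤ C * |z₁ - z₂| := by
  obtain ⟨K, _, hK⟩ := exists_abs_halfHankel_le
  refine ⟨K * 2 / Real.pi, fun z₁ z₂ hz₁ hz₂ => ?_⟩
  have hρ' : ρ ∈ Icc (0 : ℝ) 1 := ⟨hρ.1.le, hρ.2⟩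
  have h := hK (fun w => (1 + z₁ * Complex.exp (-(ρ * w)))⁻¹ - (1 + z₂ * Complex.exp (-(ρ * w)))⁻¹)
    (2 * |z₁ - z₂|) (by positivity) (fun x y hx h0 h1 => ?_)
  · have h2 := halfHankel_sub (hankelIntegrable_mittagLefflerKernel hρ' hz₁)
      (hankelIntegrable_mittagLefflerKernel hρ' hz₂)
    rw [halfHankel_mittagLefflerKernel hρ hz₁, halfHankel_mittagLefflerKernel hρ hz₂] at h2
    unfold mittagLefflerKernel at h2
    simp only [div_eq_mul_inv, ← mul_sub] at h2
    rw [h2, abs_mul, abs_of_pos Real.pi_pos] at h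
    rw [div_mul_eq_mul_div, le_div_iff₀ Real.pi_pos]
    linarith
  · have e1 := one_add_ne_zero (x := x) hρ' hz₁ h0 h1
    have e2 := one_add_ne_zero (x := x) hρ' hz₂ h0 h1
    have b1 := norm_inv_one_add_le (x := x) hρ' hz₁ h0 h1
    have b2 := norm_inv_one_add_le (x := x) hρ' hz₂ h0 h1
    rw [inv_sub_inv e1 e2, div_eq_mul_inv, mul_inv, norm_mul, norm_mul]
    have b3 : ‖1 + z₂ * Complex.exp (-(ρ * (x + y * Complex.I))) -
        (1 + z₁ * Complex.exp (-(ρ * (x + y * Complex.I))))‖ ≤ |z₁ - z₂| := by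
      rw [add_sub_add_left_eq_sub, ← sub_mul, norm_mul, norm_exp_neg_mul, ← Complex.ofReal_sub,
        Complex.norm_real, Real.norm_eq_abs, abs_sub_comm]
      refine mul_le_of_le_one_right (abs_nonneg _) (Real.exp_le_one_iff.2 ?_)
      have := mul_nonneg hρ.1.le hx
      linarith
    calc _ ≤ |z₁ - z₂| * (√2 * √2) := by gcongr
      _ = _ := by rw [Real.mul_self_sqrt (by norm_num)]; ring

/-! ### The inverse Fourier transform on `L₂` and the Fourier integral -/

section FourierLTwo

variable {V : Type*} [NormedAddCommGroup V] [InnerProductSpace ℝ V] [FiniteDimensional ℝ V]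
  [MeasurableSpace V] [BorelSpace V]

lemma integral_fourierInv_mul_eq_flip {f g : V → ℂ} (hf : Integrable f) (hg : Integrable g) :
    ∫ ξ, 𝓕⁻ f ξ * g ξ = ∫ x, f x * 𝓕⁻ g x := by
  have h := VectorFourier.integral_fourierIntegral_smul_eq_flip (L := -innerₗ V)
    (μ := volume) (ν := volume) Real.continuous_fourierChar
    ((continuous_inner (𝕜 := ℝ) (E := V)).neg.congr fun p => by simp) hf hg
  have hflip : (-innerₗ V).flip = -innerₗ V := by
    ext x y
    simp [real_inner_comm]
  rw [hflip] at h
  exact h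

lemma continuous_fourierInv_of_integrable {f : V → ℂ} (hf : Integrable f) :
    Continuous (𝓕⁻ f : V → ℂ) :=
  VectorFourier.fourierIntegral_continuous Real.continuous_fourierChar
    ((continuous_inner (𝕜 := ℝ) (E := V)).neg.congr fun p => by simp) hf

/-- For an integrable and square integrable function the inverse Fourier transform in `L₂` is given
by the Fourier integral. -/
theorem coeFn_fourierInv_toLp {f : V → ℂ} (h1 : Integrable f) (h2 : MemLp f 2) :
    ((𝓕⁻ (h2.toLp f) : Lp ℂ 2 (volume : Measure V)) : V → ℂ) =ᵐ[volume] 𝓕⁻ f := by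
  -- It suffices to compare pairings with smooth compactly supported `g`. The `L₂` transform moves
  -- onto `g` through tempered distributions, the Fourier integral through the symmetry of its
  -- kernel.
  refine ae_eq_of_integral_contDiff_smul_eq
    ((Lp.memLp _).locallyIntegrable (by norm_num))
    (continuous_fourierInv_of_integrable h1).locallyIntegrable fun g hg hgs => ?_
  have hg₁ : HasCompactSupport (Complex.ofRealCLM ∘ g) := hgs.comp_left rfl
  have hg₂ : ContDiff ℝ (⊤ : ℕ∞) (Complex.ofRealCLM ∘ g) := by fun_prop
  set G := hg₁.toSchwartzMap hg₂ with hG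
  have hGx : ∀ x, G x = (g x : ℂ) := fun x => rfl
  have ht := congrArg (fun T => T G)
    (Lp.fourierInv_toTemperedDistribution_eq (h2.toLp f))
  simp only [TemperedDistribution.fourierInv_apply, Lp.toTemperedDistribution_apply] at ht
  calc ∫ x, g x • ((𝓕⁻ (h2.toLp f) : Lp ℂ 2 (volume : Measure V)) : V → ℂ) x
      = ∫ x, G x • ((𝓕⁻ (h2.toLp f) : Lp ℂ 2 (volume : Measure V)) : V → ℂ) x := by
        simp [hGx]
    _ = ∫ x, (𝓕⁻ G) x • (h2.toLp f) x := ht.symm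
    _ = ∫ x, 𝓕⁻ (G : V → ℂ) x * f x := by
        refine integral_congr_ae ?_
        filter_upwards [h2.coeFn_toLp] with x hx
        rw [hx, smul_eq_mul, SchwartzMap.fourierInv_coe]
    _ = ∫ x, G x * 𝓕⁻ f x := integral_fourierInv_mul_eq_flip G.integrable h1
    _ = _ := by simp [hGx]

end FourierLTwo

/-! ### Values at Lebesgue points -/

section LebesgueValue

variable {N : ℕ}

lemma HasValueAt.congr_ae {f g : EuclideanSpace ℝ (Fin N) → ℂ} {ξ₀ : EuclideanSpace ℝ (Fin N)}
    {c : ℂ} (hf : HasValueAt f ξ₀ c) (h : f =ᵐ[volume] g) : HasValueAt g ξ₀ c := by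
  refine hf.congr fun r => ?_
  refine laverage_congr ((ae_restrict_of_ae h).mono fun ξ hξ => ?_)
  simp only [hξ]

/-- In `M f - M(ξ₀) c = (M - M(ξ₀)) c + M (f - c)` the first term is small near `ξ₀` by continuity,
and the second has small mean because `M` is bounded. -/
lemma HasValueAt.mul {f M : EuclideanSpace ℝ (Fin N) → ℂ} {ξ₀ : EuclideanSpace ℝ (Fin N)}
    {c : ℂ} (hf : HasValueAt f ξ₀ c) (hM : ContinuousAt M ξ₀) {C : ℝ} (hC : ∀ ξ, ‖M ξ‖ ≤ C) :
    HasValueAt (fun ξ => M ξ * f ξ) ξ₀ (M ξ₀ * c) := by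
  have hC' : ∀ ξ, ‖M ξ‖ₑ ≤ ENNReal.ofReal C := fun ξ => by
    rw [← ofReal_norm]; exact ENNReal.ofReal_le_ofReal (hC ξ)
  have hlim1 : Tendsto (fun r : ℝ => ENNReal.ofReal C *
      ⨍⁻ ξ in Metric.ball ξ₀ r, ‖f ξ - c‖ₑ ∂volume) (𝓝[>] 0) (𝓝 0) := by
    have := ENNReal.Tendsto.const_mul hf (Or.inr (ENNReal.ofReal_ne_top (r := C)))
    rwa [mul_zero] at this
  have hlim2 : Tendsto (fun ξ => ‖(M ξ - M ξ₀) * c‖ₑ) (𝓝 ξ₀) (𝓝 0) := by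
    have h1 : ContinuousAt (fun ξ => (M ξ - M ξ₀) * c) ξ₀ :=
      (hM.sub continuousAt_const).mul continuousAt_const
    have := h1.enorm
    simpa [ContinuousAt] using this
  rw [HasValueAt, ENNReal.tendsto_nhds_zero]
  intro ε hε
  have hε2 : 0 < ε / 2 := ENNReal.half_pos hε.ne'
  obtain ⟨δ, hδ, hball⟩ := Metric.eventually_nhds_iff_ball.1
    (ENNReal.tendsto_nhds_zero.1 hlim2 (ε / 2) hε2)
  filter_upwards [ENNReal.tendsto_nhds_zero.1 hlim1 (ε / 2) hε2, self_mem_nhdsWithin,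
    Iio_mem_nhds hδ |> mem_nhdsWithin_of_mem_nhds] with r hr hr0 hrδ
  have hr0 : 0 < r := hr0
  have hrδ : r < δ := hrδ
  have hv0 : volume (Metric.ball ξ₀ r) ≠ 0 := (Metric.measure_ball_pos volume ξ₀ hr0).ne'
  have hvt : volume (Metric.ball ξ₀ r) ≠ ⊤ := measure_ball_lt_top.ne
  calc ⨍⁻ ξ in Metric.ball ξ₀ r, ‖M ξ * f ξ - M ξ₀ * c‖ₑ ∂volume
      ≤ (volume (Metric.ball ξ₀ r))⁻¹ *
          ∫⁻ ξ in Metric.ball ξ₀ r, (ε / 2 + ENNReal.ofReal C * ‖f ξ - c‖ₑ) := by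
        rw [setLAverage_eq, ENNReal.div_eq_inv_mul]
        refine mul_le_mul_right (setLIntegral_mono' measurableSet_ball fun ξ hξ => ?_) _
        have hsplit : M ξ * f ξ - M ξ₀ * c = (M ξ - M ξ₀) * c + M ξ * (f ξ - c) := by ring
        rw [hsplit]
        refine (enorm_add_le _ _).trans (add_le_add ?_ ?_)
        · exact hball ξ (Metric.ball_subset_ball hrδ.le hξ)
        · rw [enorm_mul]
          exact mul_le_mul_left (hC' ξ) _
    _ = ε / 2 + ENNReal.ofReal C * ⨍⁻ ξ in Metric.ball ξ₀ r, ‖f ξ - c‖ₑ ∂volume := by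
        rw [lintegral_add_left measurable_const, lintegral_const_mul' _ _ ENNReal.ofReal_ne_top,
          setLIntegral_const, setLAverage_eq, mul_add,
          ENNReal.div_eq_inv_mul (a := ∫⁻ ξ in Metric.ball ξ₀ r, ‖f ξ - c‖ₑ), mul_comm (ε / 2),
          ← mul_assoc, ENNReal.inv_mul_cancel hv0 hvt, one_mul, mul_left_comm]
    _ ≤ ε / 2 + ε / 2 := by gcongr
    _ = ε := ENNReal.add_halves ε

end LebesgueValue

/-! ### Growth of elliptic symbols -/

section Symbol

variable {N l : ℕ} {P : MvPolynomial (Fin N) ℝ}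

lemma continuous_symbolAt (P : MvPolynomial (Fin N) ℝ) : Continuous (symbolAt P) := by
  unfold symbolAt
  exact (MvPolynomial.continuous_eval P).comp (by fun_prop)

lemma eval_smul_of_isHomogeneous {σ : Type*} {n : ℕ} {Q : MvPolynomial σ ℝ}
    (hQ : Q.IsHomogeneous n) (c : ℝ) (x : σ → ℝ) :
    MvPolynomial.eval (fun j => c * x j) Q = c ^ n * MvPolynomial.eval x Q := by
  rw [MvPolynomial.eval_eq, MvPolynomial.eval_eq, Finset.mul_sum]
  refine Finset.sum_congr rfl fun d hd => ?_
  have hdeg : ∑ i ∈ d.support, d i = n := by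
    have := hQ (MvPolynomial.mem_support_iff.1 hd)
    rw [Finsupp.weight_apply, Finsupp.sum] at this
    simpa using this
  simp_rw [mul_pow]
  rw [Finset.prod_mul_distrib, Finset.prod_pow_eq_pow_sum, hdeg]
  ring

lemma symbolAt_smul (hP : IsEllipticSymbol l P) (c : ℝ) (ξ : EuclideanSpace ℝ (Fin N)) :
    symbolAt P (c • ξ) = c ^ (2 * l) * symbolAt P ξ := by
  unfold symbolAt
  exact eval_smul_of_isHomogeneous hP.homogeneous c _

lemma symbolAt_pos (hP : IsEllipticSymbol l P) {ξ : EuclideanSpace ℝ (Fin N)} (hξ : ξ ≠ 0) :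
    0 < symbolAt P ξ := by
  refine hP.pos _ fun h => hξ ?_
  ext j
  exact congrFun h j

lemma symbolAt_nonneg (hP : IsEllipticSymbol l P) (ξ : EuclideanSpace ℝ (Fin N)) :
    0 ≤ symbolAt P ξ := by
  rcases eq_or_ne ξ 0 with rfl | h
  · have := symbolAt_smul hP 0 0
    rw [zero_pow (by have := hP.order_pos; omega), zero_mul, smul_zero] at this
    exact this.ge
  · exact (symbolAt_pos hP h).le

/-- An elliptic symbol grows at least like a multiple of its degree's power of the norm. -/
lemma exists_le_symbolAt (hP : IsEllipticSymbol l P) :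
    ∃ a : ℝ, 0 < a ∧ ∀ ξ : EuclideanSpace ℝ (Fin N), a * ‖ξ‖ ^ (2 * l) ≤ symbolAt P ξ := by
  have hl : 2 * l ≠ 0 := by have := hP.order_pos; omega
  by_cases hne : (Metric.sphere (0 : EuclideanSpace ℝ (Fin N)) 1).Nonempty
  · obtain ⟨η, hη, hmin⟩ := (isCompact_sphere (0 : EuclideanSpace ℝ (Fin N)) 1).exists_isMinOn hne
      (continuous_symbolAt P).continuousOn
    have hη0 : η ≠ 0 := by
      rintro rfl
      simp at hη
    refine ⟨symbolAt P η, symbolAt_pos hP hη0, fun ξ => ?_⟩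
    rcases eq_or_ne ξ 0 with rfl | h
    · simp [hl, symbolAt_nonneg hP]
    · have hn : 0 < ‖ξ‖ := norm_pos_iff.2 h
      have h1 : ξ = ‖ξ‖ • (‖ξ‖⁻¹ • ξ) := by rw [smul_smul, mul_inv_cancel₀ hn.ne', one_smul]
      have h2 : symbolAt P η ≤ symbolAt P (‖ξ‖⁻¹ • ξ) :=
        hmin (by simp [norm_smul, hn.ne'])
      calc symbolAt P η * ‖ξ‖ ^ (2 * l) ≤ symbolAt P (‖ξ‖⁻¹ • ξ) * ‖ξ‖ ^ (2 * l) := by gcongr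
        _ = symbolAt P ξ := by
          conv_rhs => rw [h1, symbolAt_smul hP]
          ring
  -- The unit sphere is empty only when the origin is the sole point (`N = 0`); both sides then
  -- vanish.
  · refine ⟨1, one_pos, fun ξ => ?_⟩
    have : ξ = 0 := by
      by_contra h
      exact hne ⟨‖ξ‖⁻¹ • ξ, by simp [norm_smul, norm_ne_zero_iff.2 h]⟩
    subst this
    simp [hl, symbolAt_nonneg hP]

/-- Boundedness gives the truncation domain finite volume, so truncated `L₂` spectra are integrable
and the truncated solution is a genuine Fourier integral. -/
lemma isBounded_symbolAt_lt (hP : IsEllipticSymbol l P) (μ : ℝ) :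
    Bornology.IsBounded {ξ : EuclideanSpace ℝ (Fin N) | symbolAt P ξ < μ} := by
  obtain ⟨a, ha, hle⟩ := exists_le_symbolAt hP
  have ht : Tendsto (fun r : ℝ => a * r ^ (2 * l)) atTop atTop :=
    (tendsto_pow_atTop (by have := hP.order_pos; omega)).const_mul_atTop ha
  obtain ⟨R, hR⟩ := eventually_atTop.1 (ht.eventually_ge_atTop μ)
  refine (Metric.isBounded_ball (x := (0 : EuclideanSpace ℝ (Fin N))) (r := R)).subset
    fun ξ hξ => ?_
  rw [mem_ball_zero_iff]
  by_contra! h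
  exact absurd (hξ.trans_le ((hR _ h).trans (hle ξ))) (lt_irrefl _)

end Symbol

/-! ### The forward solution as a Fourier multiplier -/

section ForwardSolution

variable {N l : ℕ} {P : MvPolynomial (Fin N) ℝ} {ρ t : ℝ}

/-- The Fourier multiplier `E_ρ(-A(ξ) t ^ ρ)` of the solution operator. -/
def solutionMultiplier (P : MvPolynomial (Fin N) ℝ) (ρ t : ℝ) (ξ : EuclideanSpace ℝ (Fin N)) : ℂ :=
  mittagLeffler ρ (-(symbolAt P ξ * t ^ ρ))

lemma continuous_solutionMultiplier (hP : IsEllipticSymbol l P) (hρ : ρ ∈ Ioc (0 : ℝ) 1)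
    (ht : 0 ≤ t) : Continuous (solutionMultiplier P ρ t) := by
  obtain ⟨C, hC⟩ := exists_abs_mittagLeffler_neg_sub_le hρ
  have hcont : ContinuousOn (fun z => mittagLeffler ρ (-z)) (Ici 0) := by
    refine (LipschitzOnWith.of_dist_le_mul (K := C.toNNReal) fun x hx y hy => ?_).continuousOn
    rw [Real.dist_eq, Real.dist_eq]
    refine (hC x y hx hy).trans ?_
    gcongr
    exact Real.le_coe_toNNReal C
  refine Complex.continuous_ofReal.comp (hcont.comp_continuous
    (f := fun ξ => symbolAt P ξ * t ^ ρ) ((continuous_symbolAt P).mul continuous_const) fun ξ => ?_)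
  exact mul_nonneg (symbolAt_nonneg hP ξ) (Real.rpow_nonneg ht ρ)

lemma exists_norm_solutionMultiplier_le (hP : IsEllipticSymbol l P) (hρ : ρ ∈ Ioc (0 : ℝ) 1)
    (ht : 0 ≤ t) : ∃ C : ℝ, ∀ ξ, ‖solutionMultiplier P ρ t ξ‖ ≤ C := by
  obtain ⟨C, hC⟩ := exists_abs_mittagLeffler_neg_le hρ
  refine ⟨C, fun ξ => ?_⟩
  rw [solutionMultiplier, Complex.norm_real]
  exact hC _ (mul_nonneg (symbolAt_nonneg hP ξ) (Real.rpow_nonneg ht ρ))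

/-- The `L₂` Fourier transform (in Mathlib's normalization) of the solution. -/
def solutionSpectrum (P : MvPolynomial (Fin N) ℝ) (φ : LTwo N) (ρ t : ℝ)
    (η : EuclideanSpace ℝ (Fin N)) : ℂ :=
  solutionMultiplier P ρ t ((2 * Real.pi) • η) * (𝓕 φ : LTwo N) η

/-- The frequencies, in Mathlib's normalization, at which the symbol is less than `μ`. -/
def lowFrequencies (P : MvPolynomial (Fin N) ℝ) (μ : ℝ) : Set (EuclideanSpace ℝ (Fin N)) :=
  {η | symbolAt P ((2 * Real.pi) • η) < μ}

lemma measurableSet_lowFrequencies (P : MvPolynomial (Fin N) ℝ) (μ : ℝ) :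
    MeasurableSet (lowFrequencies P μ) :=
  (isOpen_lt ((continuous_symbolAt P).comp (continuous_const_smul _)) continuous_const).measurableSet

lemma volume_lowFrequencies_lt_top (hP : IsEllipticSymbol l P) (μ : ℝ) :
    volume (lowFrequencies P μ) < ⊤ := by
  refine Bornology.IsBounded.measure_lt_top ?_
  refine ((isBounded_symbolAt_lt hP μ).smul₀ (2 * Real.pi)⁻¹).subset fun η hη => ?_
  exact ⟨(2 * Real.pi) • η, hη, by
    simp only [smul_smul]
    rw [inv_mul_cancel₀ (by positivity), one_smul]⟩

lemma memLp_solutionSpectrum (hP : IsEllipticSymbol l P) (hρ : ρ ∈ Ioc (0 : ℝ) 1) (ht : 0 ≤ t)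
    (φ : LTwo N) : MemLp (solutionSpectrum P φ ρ t) 2 := by
  obtain ⟨C, hC⟩ := exists_norm_solutionMultiplier_le hP hρ ht
  have hm : Continuous fun η => solutionMultiplier P ρ t ((2 * Real.pi) • η) :=
    (continuous_solutionMultiplier hP hρ ht).comp (continuous_const_smul _)
  refine (Lp.memLp (𝓕 φ : LTwo N)).of_le_mul (c := C)
    (hm.aestronglyMeasurable.mul (Lp.aestronglyMeasurable _)) (Eventually.of_forall fun η => ?_)
  unfold solutionSpectrum
  rw [norm_mul]
  gcongr
  exact hC _

lemma memLp_indicator_solutionSpectrum (hP : IsEllipticSymbol l P) (hρ : ρ ∈ Ioc (0 : ℝ) 1)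
    (ht : 0 ≤ t) (φ : LTwo N) (μ : ℝ) :
    MemLp ((lowFrequencies P μ).indicator (solutionSpectrum P φ ρ t)) 2 :=
  (memLp_solutionSpectrum hP hρ ht φ).indicator (measurableSet_lowFrequencies P μ)

lemma integrable_indicator_solutionSpectrum (hP : IsEllipticSymbol l P)
    (hρ : ρ ∈ Ioc (0 : ℝ) 1) (ht : 0 ≤ t) (φ : LTwo N) (μ : ℝ) :
    Integrable ((lowFrequencies P μ).indicator (solutionSpectrum P φ ρ t)) := by
  rw [integrable_indicator_iff (measurableSet_lowFrequencies P μ)]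
  have : IsFiniteMeasure (volume.restrict (lowFrequencies P μ)) :=
    ⟨by rw [Measure.restrict_apply_univ]; exact volume_lowFrequencies_lt_top hP μ⟩
  exact ((memLp_solutionSpectrum hP hρ ht φ).restrict _).integrable (by norm_num)

/-- The substitution `ξ = 2π η` has Jacobian `(2π) ^ N`, which cancels the normalizing factor in
`fourierHat`. -/
lemma truncatedSolution_eq (φ : LTwo N) (μ : ℝ) (x : EuclideanSpace ℝ (Fin N)) :
    truncatedSolution P φ ρ t μ x =
      𝓕⁻ ((lowFrequencies P μ).indicator (solutionSpectrum P φ ρ t)) x := by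
  have h2π : (0 : ℝ) < 2 * Real.pi := by positivity
  have hmeas : MeasurableSet {ξ : EuclideanSpace ℝ (Fin N) | symbolAt P ξ < μ} :=
    (isOpen_lt (continuous_symbolAt P) continuous_const).measurableSet
  rw [truncatedSolution, ← integral_indicator hmeas, Real.fourierInv_eq']
  have hscale := Measure.integral_comp_smul (volume : Measure (EuclideanSpace ℝ (Fin N)))
    ({ξ : EuclideanSpace ℝ (Fin N) | symbolAt P ξ < μ}.indicator fun ξ =>
      (mittagLeffler ρ (-(symbolAt P ξ * t ^ ρ)) : ℂ) * fourierHat φ ξ *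
        Complex.exp (Complex.I * (inner ℝ x ξ : ℝ))) (2 * Real.pi)
  rw [finrank_euclideanSpace_fin, abs_of_pos (by positivity)] at hscale
  have hpow : ((2 * Real.pi) ^ N : ℝ) ≠ 0 := by positivity
  rw [eq_comm, inv_smul_eq_iff₀ hpow] at hscale
  rw [hscale, ← integral_smul]
  congr 1 with η
  by_cases hη : η ∈ lowFrequencies P μ
  · have hη' : (2 * Real.pi) • η ∈ {ξ : EuclideanSpace ℝ (Fin N) | symbolAt P ξ < μ} := hη
    rw [indicator_of_mem hη, indicator_of_mem hη', solutionSpectrum, solutionMultiplier, fourierHat,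
      smul_smul, inv_mul_cancel₀ h2π.ne', one_smul, inner_smul_right, real_inner_comm,
      Complex.real_smul, smul_eq_mul, mul_comm Complex.I]
    have hc : (((2 * Real.pi) ^ N : ℝ) : ℂ) ≠ 0 := Complex.ofReal_ne_zero.2 hpow
    rw [Complex.ofReal_inv]
    field_simp
  · have hη' : (2 * Real.pi) • η ∉ {ξ : EuclideanSpace ℝ (Fin N) | symbolAt P ξ < μ} := hη
    rw [indicator_of_notMem hη, indicator_of_notMem hη', smul_zero, smul_zero]

/-- Dominated convergence: at each frequency the truncation is inactive as soon as `μ` exceeds the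
symbol there. -/
lemma tendsto_toLp_indicator (hP : IsEllipticSymbol l P) (hρ : ρ ∈ Ioc (0 : ℝ) 1) (ht : 0 ≤ t)
    (φ : LTwo N) :
    Tendsto (fun μ : ℝ => (memLp_indicator_solutionSpectrum hP hρ ht φ μ).toLp _) atTop
      (𝓝 ((memLp_solutionSpectrum hP hρ ht φ).toLp _)) := by
  rw [Lp.tendsto_Lp_iff_tendsto_eLpNorm'']
  have hG := memLp_solutionSpectrum hP hρ ht φ
  have hfin : ∫⁻ η, ‖solutionSpectrum P φ ρ t η‖ₑ ^ (2 : ℝ) ≠ ⊤ := by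
    have := hG.eLpNorm_lt_top
    rw [eLpNorm_lt_top_iff_lintegral_rpow_enorm_lt_top (by norm_num) (by norm_num)] at this
    simpa using this.ne
  have hlim : Tendsto (fun μ : ℝ => ∫⁻ η,
      ‖((lowFrequencies P μ).indicator (solutionSpectrum P φ ρ t) - solutionSpectrum P φ ρ t) η‖ₑ ^
        (2 : ℝ)) atTop (𝓝 (∫⁻ _ : EuclideanSpace ℝ (Fin N), 0)) := by
    refine tendsto_lintegral_filter_of_dominated_convergence'
      (fun η => ‖solutionSpectrum P φ ρ t η‖ₑ ^ (2 : ℝ)) ?_ ?_ hfin ?_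
    · refine Eventually.of_forall fun μ => ?_
      exact ((memLp_indicator_solutionSpectrum hP hρ ht φ μ).sub
        hG).aestronglyMeasurable.enorm.pow_const _
    · refine Eventually.of_forall fun μ => Eventually.of_forall fun η => ?_
      refine ENNReal.rpow_le_rpow ?_ (by norm_num)
      by_cases hη : η ∈ lowFrequencies P μ <;> simp [hη]
    · refine Eventually.of_forall fun η => ?_
      refine tendsto_const_nhds.congr' ?_
      filter_upwards [eventually_gt_atTop (symbolAt P ((2 * Real.pi) • η))] with μ hμ
      have hη : η ∈ lowFrequencies P μ := hμ
      simp [hη]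
  rw [lintegral_zero] at hlim
  have := hlim.ennrpow_const (1 / 2)
  rw [ENNReal.zero_rpow_of_pos (by norm_num)] at this
  refine this.congr fun μ => ?_
  rw [eLpNorm_eq_lintegral_rpow_enorm_toReal (by norm_num) (by norm_num)]
  simp

/-- The forward solution is the inverse Fourier transform of its spectrum. -/
theorem isForwardSolution_iff (hP : IsEllipticSymbol l P) (hρ : ρ ∈ Ioc (0 : ℝ) 1) (ht : 0 ≤ t)
    (φ u : LTwo N) :
    IsForwardSolution P φ ρ t u ↔
      u = 𝓕⁻ ((memLp_solutionSpectrum hP hρ ht φ).toLp _ : LTwo N) := by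
  have hS (μ : ℝ) := coeFn_fourierInv_toLp (integrable_indicator_solutionSpectrum hP hρ ht φ μ)
    (memLp_indicator_solutionSpectrum hP hρ ht φ μ)
  -- The inverse transform is an isometry of `L₂`, so convergence of the spectra passes to the
  -- truncated solutions; uniqueness of limits identifies `u`.
  have hlim := ((Lp.fourierTransformₗᵢ (EuclideanSpace ℝ (Fin N)) ℂ).symm.continuous.tendsto
    _).comp (tendsto_toLp_indicator hP hρ ht φ)
  have hiff : IsForwardSolution P φ ρ t u ↔
      Tendsto (fun μ : ℝ => (𝓕⁻ ((memLp_indicator_solutionSpectrum hP hρ ht φ μ).toLp _ : LTwo N) :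
        LTwo N)) atTop (𝓝 u) := by
    rw [Lp.tendsto_Lp_iff_tendsto_eLpNorm', IsForwardSolution]
    refine tendsto_congr fun μ => eLpNorm_congr_ae ?_
    filter_upwards [hS μ] with x hx
    rw [truncatedSolution_eq, Pi.sub_apply, hx]
  rw [hiff]
  constructor
  · exact fun h => tendsto_nhds_unique h hlim
  · rintro rfl
    exact hlim

lemma fourierHat_forwardSolution (hP : IsEllipticSymbol l P) (hρ : ρ ∈ Ioc (0 : ℝ) 1)
    (ht : 0 ≤ t) {φ u : LTwo N} (hu : IsForwardSolution P φ ρ t u) :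
    fourierHat u =ᵐ[volume] fun ξ => solutionMultiplier P ρ t ξ * fourierHat φ ξ := by
  have h2π : (2 * Real.pi) ≠ 0 := by positivity
  have hFu : (𝓕 u : LTwo N) = (memLp_solutionSpectrum hP hρ ht φ).toLp _ := by
    rw [(isForwardSolution_iff hP hρ ht φ u).1 hu, fourier_fourierInv_eq]
  have hae : ((𝓕 u : LTwo N) : EuclideanSpace ℝ (Fin N) → ℂ) =ᵐ[volume]
      solutionSpectrum P φ ρ t := by
    rw [hFu]
    exact (memLp_solutionSpectrum hP hρ ht φ).coeFn_toLp
  have hcomp := (Measure.quasiMeasurePreserving_smul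
    (volume : Measure (EuclideanSpace ℝ (Fin N))) (inv_ne_zero h2π)).ae_eq_comp hae
  filter_upwards [hcomp] with ξ hξ
  simp only [Function.comp] at hξ
  rw [fourierHat, fourierHat, hξ, solutionSpectrum, smul_smul, mul_inv_cancel₀ h2π, one_smul]
  ring

lemma hasValueAt_forwardSolution (hP : IsEllipticSymbol l P) (hρ : ρ ∈ Ioc (0 : ℝ) 1)
    (ht : 0 ≤ t) {φ u : LTwo N} (hu : IsForwardSolution P φ ρ t u)
    {ξ₀ : EuclideanSpace ℝ (Fin N)} {c : ℂ} (hc : HasValueAt (fourierHat φ) ξ₀ c) :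
    HasValueAt (fourierHat u) ξ₀ (solutionMultiplier P ρ t ξ₀ * c) := by
  obtain ⟨C, hC⟩ := exists_norm_solutionMultiplier_le hP hρ ht
  exact (hc.mul (continuous_solutionMultiplier hP hρ ht).continuousAt hC).congr_ae
    (fourierHat_forwardSolution hP hρ ht hu).symm

end ForwardSolution

end

/-! ### The main theorem -/

theorem lemma3p1 (ρ₀ lam₀ : ℝ) (hρ₀ : ρ₀ ∈ Set.Ioo (0 : ℝ) 1) (hlam₀ : 0 < lam₀) :
    (∃ k : ℝ, AdmissibleExponent lam₀ ρ₀ k) ∧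
    ∀ k : ℝ, AdmissibleExponent lam₀ ρ₀ k → ∀ t₀ : ℝ, Real.exp k ≤ t₀ →
      (∀ lam : ℝ, lam₀ ≤ lam →
        (∀ ρ ∈ Set.Ico ρ₀ 1, 0 < eFun lam t₀ ρ) ∧
        StrictAntiOn (fun ρ => eFun lam t₀ ρ) (Set.Ico ρ₀ 1) ∧
        (∀ ρ ∈ Set.Ico ρ₀ 1, eFun lam t₀ 1 < eFun lam t₀ ρ ∧ eFun lam t₀ ρ ≤ eFun lam t₀ ρ₀)) ∧
      (∀ (N l : ℕ) (P : MvPolynomial (Fin N) ℝ), IsEllipticSymbol l P →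
        ∀ (φ : LTwo N) (ξ₀ : EuclideanSpace ℝ (Fin N)) (c : ℂ),
          ξ₀ ≠ 0 → symbolAt P ξ₀ = lam₀ → HasValueAt (fourierHat φ) ξ₀ c → c ≠ 0 →
          (∀ ρ ∈ Set.Icc ρ₀ 1, ∃! u : LTwo N, IsForwardSolution P φ ρ t₀ u) ∧
          ∀ u : ℝ → LTwo N, (∀ ρ ∈ Set.Icc ρ₀ 1, IsForwardSolution P φ ρ t₀ (u ρ)) →
            ∃ v : ℝ → ℂ,
              (∀ ρ ∈ Set.Icc ρ₀ 1, HasValueAt (fourierHat (u ρ)) ξ₀ (v ρ)) ∧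
              StrictAntiOn (fun ρ => ‖v ρ‖) (Set.Icc ρ₀ 1)) := by
  refine ⟨exists_admissibleExponent hρ₀.1 hlam₀, fun k hk t₀ ht₀ => ?_⟩
  have ht0 : 0 < t₀ := (Real.exp_pos k).trans_le ht₀
  obtain ⟨hℓ, hz⟩ := hk.bounds hρ₀ hlam₀ ((Real.le_log_iff_exp_le ht0).2 ht₀)
  have hanti : ∀ lam : ℝ, lam₀ ≤ lam → StrictAntiOn (fun ρ => eFun lam t₀ ρ) (Icc ρ₀ 1) := by
    intro lam hlam
    have h := strictAntiOn_eFun (hlam₀.trans_le hlam) hℓ hρ₀.1 (hz.trans (by gcongr))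
    rwa [Real.exp_log ht0] at h
  -- Monotonicity up to and including `ρ = 1` bounds every value below by an exponential.
  have hpos : ∀ lam : ℝ, lam₀ ≤ lam → ∀ ρ ∈ Icc ρ₀ 1, 0 < eFun lam t₀ ρ := fun lam hlam ρ hρ =>
    (eFun_one_pos lam t₀).trans_le
      ((hanti lam hlam).antitoneOn hρ (right_mem_Icc.2 hρ₀.2.le) hρ.2)
  refine ⟨fun lam hlam => ⟨fun ρ hρ => hpos lam hlam ρ ⟨hρ.1, hρ.2.le⟩,
    (hanti lam hlam).mono Ico_subset_Icc_self, fun ρ hρ => ⟨?_, ?_⟩⟩, ?_⟩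
  · exact hanti lam hlam ⟨hρ.1, hρ.2.le⟩ (right_mem_Icc.2 hρ₀.2.le) hρ.2
  · exact (hanti lam hlam).antitoneOn (left_mem_Icc.2 hρ₀.2.le) ⟨hρ.1, hρ.2.le⟩ hρ.1
  · intro N l P hP φ ξ₀ c _ hξ₀ hc hc0
    have hIoc : ∀ ρ ∈ Icc ρ₀ 1, ρ ∈ Ioc (0 : ℝ) 1 := fun ρ hρ => ⟨hρ₀.1.trans_le hρ.1, hρ.2⟩
    refine ⟨fun ρ hρ => ⟨_, (isForwardSolution_iff hP (hIoc ρ hρ) ht0.le φ _).2 rfl,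
      fun u hu => (isForwardSolution_iff hP (hIoc ρ hρ) ht0.le φ u).1 hu⟩, fun u hu => ?_⟩
    refine ⟨fun ρ => solutionMultiplier P ρ t₀ ξ₀ * c, fun ρ hρ =>
      hasValueAt_forwardSolution hP (hIoc ρ hρ) ht0.le (hu ρ hρ) hc, fun ρ hρ σ hσ hlt => ?_⟩
    have hnorm : ∀ τ ∈ Icc ρ₀ 1,
        ‖solutionMultiplier P τ t₀ ξ₀ * c‖ = eFun lam₀ t₀ τ * ‖c‖ := by
      intro τ hτ
      have h := hpos lam₀ le_rfl τ hτ
      rw [eFun] at h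
      rw [norm_mul, solutionMultiplier, hξ₀, Complex.norm_real, Real.norm_of_nonneg h.le, eFun]
    simp only [hnorm ρ hρ, hnorm σ hσ]
    exact mul_lt_mul_of_pos_right (hanti lam₀ le_rfl hρ hσ hlt) (norm_pos_iff.2 hc0)
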